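/- Let $d\ge 1$ and $n\ge 1$ be integers. For $\lambda>0$ let $\eta$ be a homogeneous Poisson point process in $\mathbb{R}^d$ of intensity $\lambda$. For $x\in\eta$ let $\upsilon_\eta(x)=\{z\in\mathbb{R}^d:\ \|z-x\|\le\|z-y\|\text{ for all }y\in\eta\}$ be the Voronoi cell of $x$, where $\|\cdot\|$ is the Euclidean norm. For a Borel set $A\subset\mathbb{R}^d$ let $$A_\eta=\bigcup_{x\in\eta\cap A}\upsilon_\eta(x)$$ be the Poisson--Voronoi approximation of $A$, and let $\mathrm{Vol}$ denote Lebesgue measure. There is a constant $C_{n,d}$, depending only on $n$ and $d$, such that for every Borel set $A\subset\mathbb{R}^d$ with $\mathrm{Vol}(A)<\infty$ the following hold. (i) For every $\lambda>0$, $\mathrm{Vol}(A_\eta)$ is almost surely finite, its $n$-th moment is finite, and $$\Big|\mathbb{E}\,\mathrm{Vol}^n(A_\eta)-\mathrm{Vol}^n(A)\Big|\le C_{n,d}\sum_{k=1}^{n-1}\mathrm{Vol}^{n-k}(A)\,\lambda^{-k}.$$ (ii) There is $\lambda_0>0$, which may depend on $A$, $n$ and $d$, such that for every $\lambda\ge\lambda_0$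 $$\Big|\mathbb{E}\,\mathrm{Vol}^n(A_\eta)-\mathrm{Vol}^n(A)\Big|\le C_{n,d}\,\mathrm{Vol}^{n-1}(A)\,\lambda^{-1}.$$ Here $\mathrm{Vol}^m(\cdot)$ is the $m$-th power of the volume, $\mathrm{Vol}^0(A)=1$, and for $n=1$ the sum in (i) is empty, hence zero. -/

import Mathlib

open MeasureTheory ProbabilityTheory

open scoped NNReal ENNReal

universe u

noncomputable section

/-- The Euclidean space `ℝ^d`, with its Euclidean norm and Lebesgue measure `volume`. -/
abbrev Space (d : ℕ) : Type := EuclideanSpace ℝ (Fin d)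

/-- The number of points of the configuration `S` in the set `B` (possibly infinite). -/
def pointCount {d : ℕ} (S B : Set (Space d)) : ℕ∞ := (S ∩ B).encard

/-- `η` is a homogeneous Poisson point process in `ℝ^d` of intensity `lam` on the probability space
`(Ω, P)`: a random locally finite set of points whose number of points in a Borel set of finite
volume has the Poisson distribution with mean `lam` times that volume, and whose numbers of points
in pairwise disjoint Borel sets are independent. -/
structure IsPoissonProcess {d : ℕ} {Ω : Type*} [MeasurableSpace Ω] (P : Measure Ω) (lam : ℝ)
    (η : Ω → Set (Space d)) : Prop where
  locallyFinite : ∀ ω : Ω, ∀ B : Set (Space d), Bornology.IsBounded B → (η ω ∩ B).Finite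
  measurable_count : ∀ B : Set (Space d), MeasurableSet B →
    Measurable (fun ω => pointCount (η ω) B)
  law_count : ∀ B : Set (Space d), MeasurableSet B → volume B ≠ ∞ →
    P.map (fun ω => pointCount (η ω) B) =
      (poissonMeasure (lam.toNNReal * (volume B).toNNReal)).map (fun k : ℕ => (k : ℕ∞))
  indep_count : ∀ (m : ℕ) (B : Fin m → Set (Space d)), (∀ i, MeasurableSet (B i)) →
    Pairwise (fun i j => Disjoint (B i) (B j)) →
    iIndepFun (fun (i : Fin m) (ω : Ω) => pointCount (η ω) (B i)) P

/-- The Voronoi cell generated by the point set `S` with nucleus `x`. -/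
def voronoiCell {d : ℕ} (S : Set (Space d)) (x : Space d) : Set (Space d) :=
  {z | ∀ y ∈ S, ‖z - x‖ ≤ ‖z - y‖}

/-- The Voronoi approximation of `A` by `S`: the union of the Voronoi cells of `S` whose nuclei
lie in `A`. -/
def voronoiApprox {d : ℕ} (S A : Set (Space d)) : Set (Space d) :=
  ⋃ x ∈ S ∩ A, voronoiCell S x

end

/-! Let X(z) (`nearestDist`) be the distance from z to the nearest point of η if that point lies in
A, and ∞ otherwise. Then z ∈ A_η iff X(z) < ∞, so E Vol^n(A_η) is the integral over (z₁,…,z_n) of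
P(all X(z_i) < ∞). Since E Vol(A_η) = Vol(A), the power Vol^n(A) is the same integral for n
independent copies of X. Whether X(z) < r, and the value of X(z) in that case, depend only on the
points of η in the open ball of radius r about z. Hence, as long as the balls of radius X(z_i) about
z_i are disjoint, the X(z_i) follow the product law (`IsPoissonProcess.decouplesOnSeparated`). The
two n-fold integrals share this disjoint part and differ only where two balls meet
(`exists_moment_decomposition`).

If two balls meet and the i-th is at least as large as the j-th, then z_j is within 2 X(z_i) of z_i.
Integrating z_j out costs a constant times X(z_i)^d and leaves n - 1 points, one of them weighted.
Weighted joint moments split in the same way, and induction on the number of points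
(`lintegral_prod_finitePow_le`) ends at one point. There E ∫ X^(dp) = Vol(A) E R^(dp) ≤ c_p Vol(A)
λ^(-p), where R is the distance from the origin to η (`lintegral_finitePow_nearestDist`,
`lintegral_infEDist_pow_le`).

Each point integrated out trades a factor Vol(A) for 1/λ, which gives the sum in (i). Once λ Vol(A)
≥ 1 its first term is the largest, which gives (ii). -/

/-- The integral of a product of functions of separate coordinates is the product of the
integrals. -/
lemma lintegral_pi_prod {m : ℕ} {α : Type*} [MeasurableSpace α] (μ : Measure α) [SigmaFinite μ]
    (f : Fin m → α → ℝ≥0∞) (hf : ∀ i, Measurable (f i)) :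
    ∫⁻ x, ∏ i, f i (x i) ∂(Measure.pi fun _ : Fin m => μ) = ∏ i, ∫⁻ x, f i x ∂μ := by
  induction m with
  | zero => simp
  | succ m ih =>
    have h := measurePreserving_piFinSuccAbove (fun _ : Fin (m + 1) => μ) 0
    have h1 : ∀ x : Fin (m + 1) → α, ∏ i, f i (x i) =
        (fun y : α × (Fin m → α) => f 0 y.1 * ∏ i, f (Fin.succ i) (y.2 i))
          (MeasurableEquiv.piFinSuccAbove (fun _ : Fin (m + 1) => α) 0 x) := by
      intro x
      rw [Fin.prod_univ_succ]
      rfl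
    rw [lintegral_congr h1]
    refine (h.lintegral_comp_emb (MeasurableEquiv.measurableEmbedding _)
      (fun y => f 0 y.1 * ∏ i, f (Fin.succ i) (y.2 i))).trans ?_
    rw [lintegral_prod_mul (f := f 0) (g := fun y : Fin m → α => ∏ i, f (Fin.succ i) (y i))
      (hf 0).aemeasurable
      (Finset.measurable_prod _ fun i _ => (hf _).comp (measurable_pi_apply i)).aemeasurable,
      ih _ fun i => hf _, Fin.prod_univ_succ]

/-! ### Deterministic radii: integrating out a ball that meets a larger one -/

/-- `x ^ (d * p)` for finite `x`, and `0` for `x = ∞`. -/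
noncomputable def finitePow (d p : ℕ) (x : ℝ≥0∞) : ℝ≥0∞ := if x < ∞ then x ^ (d * p) else 0

lemma measurable_finitePow (d p : ℕ) : Measurable (finitePow d p) :=
  Measurable.ite measurableSet_Iio (measurable_id.pow_const _) measurable_const

@[simp] lemma finitePow_top (d p : ℕ) : finitePow d p ∞ = 0 := by simp [finitePow]

/-- The volume of the unit ball. -/
noncomputable def unitBallVolume (d : ℕ) : ℝ≥0∞ := volume (Metric.ball (0 : Space d) 1)

lemma unitBallVolume_ne_top (d : ℕ) : unitBallVolume d ≠ ∞ := measure_ball_lt_top.ne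

lemma unitBallVolume_ne_zero (d : ℕ) : unitBallVolume d ≠ 0 :=
  (Metric.measure_ball_pos _ _ one_pos).ne'

lemma volume_closedEBall {d : ℕ} (z : Space d) {r : ℝ≥0∞} (hr : r ≠ ∞) :
    volume (Metric.closedEBall z r) = r ^ d * unitBallVolume d := by
  lift r to ℝ≥0 using hr
  rw [Metric.closedEBall_coe, Measure.addHaar_closedBall volume z r.coe_nonneg]
  simp [unitBallVolume, ENNReal.ofReal_pow]

/-- Integrating out the centre of a ball that meets a larger ball. -/
lemma lintegral_finitePow_near_le {d : ℕ} (x : Space d → ℝ≥0∞) (p q : ℕ) (y : ℝ≥0∞)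
    (w : Space d) :
    finitePow d p y * ∫⁻ z, {z | x z ≤ y ∧ edist w z ≤ y + x z}.indicator
        (fun z => finitePow d q (x z)) z ≤
      2 ^ d * unitBallVolume d * finitePow d (p + q + 1) y := by
  by_cases hy : y < ∞
  swap
  · simp [finitePow, hy]
  have h1 : ∀ z, {z | x z ≤ y ∧ edist w z ≤ y + x z}.indicator
      (fun z => finitePow d q (x z)) z ≤
      (Metric.closedEBall w (2 * y)).indicator (fun _ => y ^ (d * q)) z := by
    intro z
    by_cases hz : x z ≤ y ∧ edist w z ≤ y + x z
    · rw [Set.indicator_of_mem (by exact hz), Set.indicator_of_mem]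
      · rw [finitePow, if_pos (hz.1.trans_lt hy)]
        gcongr
        exact hz.1
      · rw [Metric.mem_closedEBall, edist_comm]
        calc _ ≤ _ := hz.2
          _ ≤ y + y := by gcongr; exact hz.1
          _ = 2 * y := (two_mul y).symm
    · rw [Set.indicator_of_notMem (by exact hz)]
      exact zero_le
  calc _ ≤ y ^ (d * p) *
        ∫⁻ z, (Metric.closedEBall w (2 * y)).indicator (fun _ => y ^ (d * q)) z := by
        rw [finitePow, if_pos hy]
        gcongr with z
        exact h1 z
    _ = _ := by
        rw [lintegral_indicator Metric.isClosed_closedEBall.measurableSet, setLIntegral_const,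
          volume_closedEBall _ (ENNReal.mul_ne_top (by simp) hy.ne), finitePow, if_pos hy]
        ring

/-- The exponents after the coordinate `j` has been integrated out against the coordinate `i`. -/
def mergeExponents {m : ℕ} (p : Fin (m + 1) → ℕ) (i j : Fin (m + 1)) (k : Fin m) : ℕ :=
  if j.succAbove k = i then p i + p j + 1 else p (j.succAbove k)

/-- The bookkeeping behind the powers of 1/λ: each merge removes one point and raises the total
exponent by one. -/
lemma sum_mergeExponents {m : ℕ} (p : Fin (m + 1) → ℕ) {i j : Fin (m + 1)} (hij : i ≠ j) :
    ∑ k, mergeExponents p i j k = ∑ k, p k + 1 := by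
  obtain ⟨l, rfl⟩ := Fin.exists_succAbove_eq hij
  have h : ∀ k, mergeExponents p (j.succAbove l) j k =
      p (j.succAbove k) + if k = l then p j + 1 else 0 := by
    intro k
    simp only [mergeExponents, (Fin.succAbove_right_injective).eq_iff]
    split_ifs with h
    · rw [h]; ring
    · rfl
  simp_rw [h, Finset.sum_add_distrib, Fin.sum_univ_succAbove p j]
  simp
  ring

/-- The centres and radii for which the `i`-th ball is at least as large as the `j`-th one, and
meets it. -/
def meetSet {d m : ℕ} (x : Fin m → Space d → ℝ≥0∞) (i j : Fin m) : Set (Fin m → Space d) :=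
  {z | x j (z j) ≤ x i (z i) ∧ edist (z i) (z j) ≤ x i (z i) + x j (z j)}

/-- By Tonelli the centre `z j` is integrated first, with the others fixed. It is confined to a ball
about `z i`, so `lintegral_finitePow_near_le` turns its weight into extra weight at `i`; the
remaining integral factorises. -/
lemma lintegral_meetSet_le {d m : ℕ} (x : Fin (m + 1) → Space d → ℝ≥0∞)
    (hx : ∀ i, Measurable (x i)) (p : Fin (m + 1) → ℕ) {i j : Fin (m + 1)} (hij : i ≠ j) :
    ∫⁻ z, (meetSet x i j).indicator (fun z => ∏ k, finitePow d (p k) (x k (z k))) z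
        ∂(Measure.pi fun _ => volume) ≤
      2 ^ d * unitBallVolume d *
        ∏ k, ∫⁻ z, finitePow d (mergeExponents p i j k) (x (j.succAbove k) z) := by
  obtain ⟨l, rfl⟩ := Fin.exists_succAbove_eq hij
  have hφ : ∀ k q, Measurable fun z => finitePow d q (x k z) :=
    fun k q => (measurable_finitePow d q).comp (hx k)
  let S : Set (Space d × (Fin m → Space d)) := {y | x j y.1 ≤ x (j.succAbove l) (y.2 l) ∧
    edist (y.2 l) y.1 ≤ x (j.succAbove l) (y.2 l) + x j y.1}
  have hS : MeasurableSet S := by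
    have h1 : Measurable fun y : Space d × (Fin m → Space d) => x j y.1 :=
      (hx j).comp measurable_fst
    have h2 : Measurable fun y : Space d × (Fin m → Space d) => x (j.succAbove l) (y.2 l) :=
      (hx _).comp ((measurable_pi_apply l).comp measurable_snd)
    have h3 : Measurable fun y : Space d × (Fin m → Space d) => edist (y.2 l) y.1 :=
      ((measurable_pi_apply l).comp measurable_snd).edist measurable_fst
    exact (measurableSet_le h1 h2).inter (measurableSet_le h3 (h2.add h1))
  let F : Space d × (Fin m → Space d) → ℝ≥0∞ := S.indicator fun y =>
    finitePow d (p j) (x j y.1) *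
      ∏ k, finitePow d (p (j.succAbove k)) (x (j.succAbove k) (y.2 k))
  have hF : Measurable F := by
    refine Measurable.indicator ?_ hS
    refine ((hφ _ _).comp measurable_fst).mul ?_
    exact Finset.measurable_prod _ fun k _ =>
      (hφ _ _).comp ((measurable_pi_apply k).comp measurable_snd)
  have h := measurePreserving_piFinSuccAbove (fun _ : Fin (m + 1) => (volume : Measure (Space d))) j
  have h1 : ∀ z : Fin (m + 1) → Space d, (meetSet x (j.succAbove l) j).indicator
      (fun z => ∏ k, finitePow d (p k) (x k (z k))) z =
      F (MeasurableEquiv.piFinSuccAbove (fun _ : Fin (m + 1) => Space d) j z) := by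
    intro z
    have : MeasurableEquiv.piFinSuccAbove (fun _ : Fin (m + 1) => Space d) j z =
      (z j, fun k => z (j.succAbove k)) := rfl
    rw [this]
    simp only [F, S, meetSet, Set.indicator_apply, Set.mem_ofPred_eq, Fin.prod_univ_succAbove _ j]
  rw [lintegral_congr h1, h.lintegral_comp_emb (MeasurableEquiv.measurableEmbedding _),
    lintegral_prod_symm _ hF.aemeasurable,
    ← lintegral_pi_prod volume (fun k z => finitePow d (mergeExponents p (j.succAbove l) j k)
      (x (j.succAbove k) z)) (fun k => hφ _ _), ← lintegral_const_mul]
  swap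
  · exact Finset.measurable_prod _ fun k _ => (hφ _ _).comp (measurable_pi_apply k)
  refine lintegral_mono fun y => ?_
  have h2 : ∀ z, F (z, y) = (∏ k, finitePow d (p (j.succAbove k)) (x (j.succAbove k) (y k))) *
      {z | x j z ≤ x (j.succAbove l) (y l) ∧ edist (y l) z ≤ x (j.succAbove l) (y l) +
        x j z}.indicator (fun z => finitePow d (p j) (x j z)) z := by
    intro z
    simp only [F, S, Set.indicator_apply, Set.mem_ofPred_eq]
    split_ifs
    · rw [mul_comm]
    · simp
  have h3 : Measurable fun z => {z | x j z ≤ x (j.succAbove l) (y l) ∧ edist (y l) z ≤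
      x (j.succAbove l) (y l) + x j z}.indicator (fun z => finitePow d (p j) (x j z)) z :=
    (hφ _ _).indicator ((measurableSet_le (hx j) measurable_const).inter
      (measurableSet_le (measurable_const.edist measurable_id) (measurable_const.add (hx j))))
  simp_rw [h2]
  -- Only the coordinate `l`, which represents `i` once `j` is removed, changes its exponent; it is
  -- split off from both products.
  rw [lintegral_const_mul _ h3, ← Finset.mul_prod_erase _ _ (Finset.mem_univ l),
    ← Finset.mul_prod_erase Finset.univ (fun k => finitePow d
      (mergeExponents p (j.succAbove l) j k) (x (j.succAbove k) (y k))) (Finset.mem_univ l)]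
  have h4 : ∀ k ∈ Finset.univ.erase l, finitePow d (mergeExponents p (j.succAbove l) j k)
      (x (j.succAbove k) (y k)) = finitePow d (p (j.succAbove k)) (x (j.succAbove k) (y k)) := by
    intro k hk
    simp [mergeExponents, (Fin.succAbove_right_injective).eq_iff, Finset.ne_of_mem_erase hk]
  rw [Finset.prod_congr rfl h4, mul_right_comm, ← mul_assoc (2 ^ d * _)]
  refine mul_le_mul' ?_ le_rfl
  have h5 : mergeExponents p (j.succAbove l) j l = p (j.succAbove l) + p j + 1 := by
    simp [mergeExponents]
  rw [h5]
  exact lintegral_finitePow_near_le (x j) (p (j.succAbove l)) (p j)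
    (x (j.succAbove l) (y l)) (y l)

/-- The finite radii for which the balls with centres `z` are pairwise disjoint. -/
def separatedRadii {d m : ℕ} (z : Fin m → Space d) : Set (Fin m → ℝ≥0∞) :=
  {r | (∀ i, r i < ∞) ∧ ∀ i j, i ≠ j → r i + r j < edist (z i) (z j)}

lemma measurableSet_separatedRadii_prod {d m : ℕ} :
    MeasurableSet {y : (Fin m → Space d) × (Fin m → ℝ≥0∞) | y.2 ∈ separatedRadii y.1} := by
  have h : ∀ i, Measurable fun y : (Fin m → Space d) × (Fin m → ℝ≥0∞) => y.2 i :=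
    fun i => (measurable_pi_apply i).comp measurable_snd
  have h' : ∀ i, Measurable fun y : (Fin m → Space d) × (Fin m → ℝ≥0∞) => y.1 i :=
    fun i => (measurable_pi_apply i).comp measurable_fst
  have h1 : MeasurableSet {y : (Fin m → Space d) × (Fin m → ℝ≥0∞) | ∀ i, y.2 i < ∞} := by
    rw [Set.ofPred_forall]
    exact MeasurableSet.iInter fun i => measurableSet_lt (h i) measurable_const
  have h2 : MeasurableSet {y : (Fin m → Space d) × (Fin m → ℝ≥0∞) |
      ∀ i j, i ≠ j → y.2 i + y.2 j < edist (y.1 i) (y.1 j)} := by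
    simp_rw [Set.ofPred_forall]
    exact MeasurableSet.iInter fun i => MeasurableSet.iInter fun j => MeasurableSet.iInter fun _ =>
      measurableSet_lt ((h i).add (h j)) ((h' i).edist (h' j))
  exact h1.inter h2

/-- Union bound over ordered pairs, the larger radius first. An infinite radius contributes nothing,
because `finitePow` vanishes at ∞ even for exponent 0. -/
lemma prod_finitePow_not_separated_le {d m : ℕ} (x : Fin m → Space d → ℝ≥0∞) (p : Fin m → ℕ)
    (z : Fin m → Space d) :
    {z | (fun k => x k (z k)) ∉ separatedRadii z}.indicator
        (fun z => ∏ k, finitePow d (p k) (x k (z k))) z ≤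
      ∑ i, ∑ j, if i ≠ j then (meetSet x i j).indicator
        (fun z => ∏ k, finitePow d (p k) (x k (z k))) z else 0 := by
  by_cases hz : (fun k => x k (z k)) ∈ separatedRadii z
  · rw [Set.indicator_of_notMem (by simpa using hz)]
    exact zero_le
  rw [Set.indicator_of_mem (by exact hz)]
  by_cases hfin : ∀ i, x i (z i) < ∞
  swap
  · push Not at hfin
    obtain ⟨i, hi⟩ := hfin
    rw [Finset.prod_eq_zero (Finset.mem_univ i)]
    · exact zero_le
    · simp [top_le_iff.mp hi]
  have : ∃ i j, i ≠ j ∧ z ∈ meetSet x i j := by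
    simp only [separatedRadii, Set.mem_ofPred_eq, not_and, not_forall] at hz
    obtain ⟨i, j, hij, h⟩ := hz hfin
    rw [not_lt] at h
    rcases le_total (x j (z j)) (x i (z i)) with h1 | h1
    · exact ⟨i, j, hij, h1, h⟩
    · exact ⟨j, i, hij.symm, h1, by rwa [edist_comm, add_comm]⟩
  obtain ⟨i, j, hij, h⟩ := this
  calc _ = (if i ≠ j then (meetSet x i j).indicator
        (fun z => ∏ k, finitePow d (p k) (x k (z k))) z else 0) := by
        rw [if_pos hij, Set.indicator_of_mem h]
    _ ≤ _ := Finset.single_le_sum (f := fun j => if i ≠ j then (meetSet x i j).indicator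
        (fun z => ∏ k, finitePow d (p k) (x k (z k))) z else 0) (fun _ _ => zero_le)
        (Finset.mem_univ j)
    _ ≤ _ := Finset.single_le_sum (f := fun i => ∑ j, if i ≠ j then (meetSet x i j).indicator
        (fun z => ∏ k, finitePow d (p k) (x k (z k))) z else 0) (fun _ _ => zero_le)
        (Finset.mem_univ i)

lemma measurableSet_meetSet {d m : ℕ} (x : Fin m → Space d → ℝ≥0∞)
    (hx : ∀ i, Measurable (x i)) (i j : Fin m) : MeasurableSet (meetSet x i j) := by
  have h : ∀ k, Measurable fun z : Fin m → Space d => x k (z k) :=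
    fun k => (hx k).comp (measurable_pi_apply k)
  exact (measurableSet_le (h j) (h i)).inter
    (measurableSet_le ((measurable_pi_apply i).edist (measurable_pi_apply j)) ((h i).add (h j)))

lemma lintegral_not_separated_le {d m : ℕ} (x : Fin (m + 1) → Space d → ℝ≥0∞)
    (hx : ∀ i, Measurable (x i)) (p : Fin (m + 1) → ℕ) :
    ∫⁻ z, {z | (fun k => x k (z k)) ∉ separatedRadii z}.indicator
        (fun z => ∏ k, finitePow d (p k) (x k (z k))) z ∂(Measure.pi fun _ => volume) ≤
      ∑ i, ∑ j, if i ≠ j then 2 ^ d * unitBallVolume d *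
        ∏ k, ∫⁻ z, finitePow d (mergeExponents p i j k) (x (j.succAbove k) z) else 0 := by
  have hm : Measurable fun z : Fin (m + 1) → Space d => ∏ k, finitePow d (p k) (x k (z k)) :=
    Finset.measurable_prod _ fun k _ =>
      ((measurable_finitePow d _).comp (hx k)).comp (measurable_pi_apply k)
  refine (lintegral_mono (prod_finitePow_not_separated_le x p)).trans ?_
  have h : ∀ i j, Measurable fun z => if i ≠ j then (meetSet x i j).indicator
        (fun z => ∏ k, finitePow d (p k) (x k (z k))) z else 0 := by
    intro i j
    split_ifs
    · exact hm.indicator (measurableSet_meetSet x hx i j)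
    · exact measurable_const
  rw [lintegral_finsetSum _ fun i _ => Finset.measurable_sum _ fun j _ => h i j]
  refine Finset.sum_le_sum fun i _ => ?_
  rw [lintegral_finsetSum _ fun j _ => h i j]
  refine Finset.sum_le_sum fun j _ => ?_
  split_ifs with hij
  · exact lintegral_meetSet_le x hx p hij
  · simp

/-! ### Random radii: disjoint and meeting parts of the joint moments -/

section RandomRadii

variable {d m : ℕ} {Ω : Type*} [MeasurableSpace Ω]

/-- The joint moment of the radii on the event that the balls are pairwise disjoint. -/
noncomputable def separatedMoment (P : Measure Ω) (x : Ω → Fin m → Space d → ℝ≥0∞)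
    (p : Fin m → ℕ) : ℝ≥0∞ :=
  ∫⁻ ω, ∫⁻ z, {z | (fun k => x ω k (z k)) ∈ separatedRadii z}.indicator
    (fun z => ∏ k, finitePow d (p k) (x ω k (z k))) z ∂(Measure.pi fun _ => volume) ∂P

/-- The joint moment of the radii on the event that some of the balls meet. -/
noncomputable def meetingMoment (P : Measure Ω) (x : Ω → Fin m → Space d → ℝ≥0∞)
    (p : Fin m → ℕ) : ℝ≥0∞ :=
  ∫⁻ ω, ∫⁻ z, {z | (fun k => x ω k (z k)) ∉ separatedRadii z}.indicator
    (fun z => ∏ k, finitePow d (p k) (x ω k (z k))) z ∂(Measure.pi fun _ => volume) ∂P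

variable {P : Measure Ω} {x : Ω → Fin m → Space d → ℝ≥0∞}
  (hx : ∀ k, Measurable fun y : Ω × Space d => x y.1 k y.2)
include hx

lemma measurable_radii :
    Measurable fun y : Ω × (Fin m → Space d) => fun k => x y.1 k (y.2 k) :=
  measurable_pi_lambda _ fun k => (hx k).comp
    (measurable_fst.prodMk ((measurable_pi_apply k).comp measurable_snd))

lemma measurable_prod_finitePow (p : Fin m → ℕ) :
    Measurable fun y : Ω × (Fin m → Space d) => ∏ k, finitePow d (p k) (x y.1 k (y.2 k)) :=
  Finset.measurable_prod _ fun k _ => (measurable_finitePow d _).comp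
    ((measurable_pi_apply k).comp (measurable_radii hx))

lemma measurableSet_separated :
    MeasurableSet {y : Ω × (Fin m → Space d) |
      (fun k => x y.1 k (y.2 k)) ∈ separatedRadii y.2} :=
  measurableSet_separatedRadii_prod.preimage (measurable_snd.prodMk (measurable_radii hx))

lemma measurable_separated_indicator (p : Fin m → ℕ) :
    Measurable fun y : Ω × (Fin m → Space d) =>
      {z | (fun k => x y.1 k (z k)) ∈ separatedRadii z}.indicator
        (fun z => ∏ k, finitePow d (p k) (x y.1 k (z k))) y.2 :=
  (measurable_prod_finitePow hx p).indicator (measurableSet_separated hx)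

lemma lintegral_prod_eq_separated_add_meeting (p : Fin m → ℕ) :
    ∫⁻ ω, ∏ k, (∫⁻ z, finitePow d (p k) (x ω k z)) ∂P =
      separatedMoment P x p + meetingMoment P x p := by
  rw [separatedMoment, meetingMoment, ← lintegral_add_left]
  swap
  · exact (measurable_separated_indicator hx p).lintegral_prod_right'
  refine lintegral_congr fun ω => ?_
  have hω : ∀ k, Measurable (x ω k) := fun k => (hx k).comp measurable_prodMk_left
  have hS : MeasurableSet {z | (fun k => x ω k (z k)) ∈ separatedRadii z} :=
    (measurableSet_separated hx).preimage measurable_prodMk_left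
  have h : {z | (fun k => x ω k (z k)) ∉ separatedRadii z} =
      {z | (fun k => x ω k (z k)) ∈ separatedRadii z}ᶜ := rfl
  rw [← lintegral_pi_prod volume (fun k z => finitePow d (p k) (x ω k z))
    fun k => (measurable_finitePow d _).comp (hω k), h, lintegral_indicator hS,
    lintegral_indicator hS.compl, lintegral_add_compl _ hS]

end RandomRadii

lemma meetingMoment_le {d m : ℕ} {Ω : Type*} [MeasurableSpace Ω] {P : Measure Ω}
    {x : Ω → Fin (m + 1) → Space d → ℝ≥0∞}
    (hx : ∀ k, Measurable fun y : Ω × Space d => x y.1 k y.2) (p : Fin (m + 1) → ℕ) :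
    meetingMoment P x p ≤ ∑ i, ∑ j, if i ≠ j then 2 ^ d * unitBallVolume d *
      ∫⁻ ω, ∏ k, (∫⁻ z, finitePow d (mergeExponents p i j k) (x ω (j.succAbove k) z)) ∂P else 0 := by
  have hω : ∀ ω k, Measurable (x ω k) := fun ω k => (hx k).comp measurable_prodMk_left
  have hm : ∀ i j, Measurable fun ω => ∏ k, ∫⁻ z,
      finitePow d (mergeExponents p i j k) (x ω (j.succAbove k) z) := fun i j =>
    Finset.measurable_prod _ fun k _ =>
      Measurable.lintegral_prod_right' (f := fun y : Ω × Space d =>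
        finitePow d (mergeExponents p i j k) (x y.1 (j.succAbove k) y.2))
        ((measurable_finitePow d _).comp (hx _))
  have h : ∀ i j, Measurable fun ω => if i ≠ j then 2 ^ d * unitBallVolume d * ∏ k, ∫⁻ z,
      finitePow d (mergeExponents p i j k) (x ω (j.succAbove k) z) else 0 := by
    intro i j
    split_ifs
    · exact (hm i j).const_mul _
    · exact measurable_const
  refine (lintegral_mono fun ω => lintegral_not_separated_le (x ω) (hω ω) p).trans ?_
  rw [lintegral_finsetSum _ fun i _ => Finset.measurable_sum _ fun j _ => h i j]
  refine Finset.sum_le_sum fun i _ => ?_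
  rw [lintegral_finsetSum _ fun j _ => h i j]
  refine Finset.sum_le_sum fun j _ => ?_
  split_ifs with hij
  · rw [lintegral_const_mul _ (hm i j)]
  · simp

/-- The radii at centres with disjoint balls are distributed as if they were independent. -/
def DecouplesOnSeparated {d : ℕ} {Ω : Type*} [MeasurableSpace Ω] (P : Measure Ω)
    (X : Ω → Space d → ℝ≥0∞) : Prop :=
  ∀ (m : ℕ) (z : Fin m → Space d),
    (P.map fun ω k => X ω (z k)).restrict (separatedRadii z) =
      (Measure.pi fun k => P.map fun ω => X ω (z k)).restrict (separatedRadii z)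

lemma measurableSet_separatedRadii {d m : ℕ} (z : Fin m → Space d) :
    MeasurableSet (separatedRadii z) :=
  measurableSet_separatedRadii_prod.preimage measurable_prodMk_left

lemma measurable_radius_coord {d m : ℕ} {Ω : Type*} [MeasurableSpace Ω] {X : Ω → Space d → ℝ≥0∞}
    (hX : Measurable fun y : Ω × Space d => X y.1 y.2) (k : Fin m) :
    Measurable fun y : (Fin m → Ω) × Space d => X (y.1 k) y.2 :=
  Measurable.comp (g := fun y : Ω × Space d => X y.1 y.2)
    (f := fun y : (Fin m → Ω) × Space d => (y.1 k, y.2)) hX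
    (((measurable_pi_apply k).comp measurable_fst).prodMk measurable_snd)

/-- With the centres fixed by Tonelli, the integrand is a function of the vector of radii supported
on `separatedRadii z`, where the joint law and the product law agree. -/
lemma separatedMoment_eq_pi {d m : ℕ} {Ω : Type*} [MeasurableSpace Ω] {P : Measure Ω}
    [IsProbabilityMeasure P] {X : Ω → Space d → ℝ≥0∞}
    (hX : Measurable fun y : Ω × Space d => X y.1 y.2) (hdec : DecouplesOnSeparated P X)
    (p : Fin m → ℕ) :
    separatedMoment P (fun ω _ => X ω) p =
      separatedMoment (Measure.pi fun _ : Fin m => P) (fun ω k => X (ω k)) p := by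
  have hX' : ∀ k, Measurable fun y : (Fin m → Ω) × Space d => X (y.1 k) y.2 := fun k =>
    measurable_radius_coord hX k
  have hz : ∀ z : Space d, Measurable fun ω => X ω z := fun z => hX.comp measurable_prodMk_right
  refine (lintegral_lintegral_swap (measurable_separated_indicator (x := fun ω _ => X ω)
    (fun _ => hX) p).aemeasurable).trans ((lintegral_congr fun z => ?_).trans
    (lintegral_lintegral_swap (measurable_separated_indicator
      (x := fun (ω : Fin m → Ω) k => X (ω k)) hX' p).aemeasurable).symm)
  have hg : Measurable fun r : Fin m → ℝ≥0∞ => ∏ k, finitePow d (p k) (r k) :=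
    Finset.measurable_prod _ fun k _ => (measurable_finitePow d _).comp (measurable_pi_apply k)
  have hG : Measurable ((separatedRadii z).indicator
      fun r : Fin m → ℝ≥0∞ => ∏ k, finitePow d (p k) (r k)) :=
    hg.indicator (measurableSet_separatedRadii z)
  have h1 : Measurable fun ω k => X ω (z k) := measurable_pi_lambda _ fun k => hz _
  have h2 : Measurable fun (ω : Fin m → Ω) k => X (ω k) (z k) :=
    measurable_pi_lambda _ fun k => (hz _).comp (measurable_pi_apply k)
  have h3 := Measure.pi_map_pi (μ := fun _ : Fin m => P) (f := fun k ω => X ω (z k))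
    fun k => (hz (z k)).aemeasurable
  calc _ = ∫⁻ ω, (separatedRadii z).indicator
        (fun r : Fin m → ℝ≥0∞ => ∏ k, finitePow d (p k) (r k)) (fun k => X ω (z k)) ∂P := rfl
    _ = ∫⁻ ω, (separatedRadii z).indicator (fun r : Fin m → ℝ≥0∞ => ∏ k, finitePow d (p k) (r k))
        (fun k => X (ω k) (z k)) ∂(Measure.pi fun _ => P) := by
        rw [← lintegral_map hG h1, ← lintegral_map hG h2, h3,
          lintegral_indicator (measurableSet_separatedRadii z),
          lintegral_indicator (measurableSet_separatedRadii z), hdec]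
    _ = _ := rfl

/-- The expected product of integrals of radii from independent copies. -/
lemma lintegral_pi_prod_finitePow {d m : ℕ} {Ω : Type*} [MeasurableSpace Ω] {P : Measure Ω}
    [IsProbabilityMeasure P] {X : Ω → Space d → ℝ≥0∞}
    (hX : Measurable fun y : Ω × Space d => X y.1 y.2) (p : Fin m → ℕ) :
    ∫⁻ ω, ∏ k, (∫⁻ z, finitePow d (p k) (X (ω k) z)) ∂(Measure.pi fun _ : Fin m => P) =
      ∏ k, ∫⁻ ω, (∫⁻ z, finitePow d (p k) (X ω z)) ∂P :=
  lintegral_pi_prod P (fun k ω => ∫⁻ z, finitePow d (p k) (X ω z)) fun k =>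
    Measurable.lintegral_prod_right' (f := fun y : Ω × Space d => finitePow d (p k) (X y.1 y.2))
      ((measurable_finitePow d _).comp hX)

/-! ### Bounds for joint moments by induction on the number of points -/

/-- The constant in the bound for the joint moments of `m + 1` radii with total exponent `N`. -/
noncomputable def momentConst (d : ℕ) (c : ℕ → ℝ≥0∞) : ℕ → ℕ → ℝ≥0∞
  | 0, N => c N
  | m + 1, N => (∑ q ∈ Finset.range (N + 1), c q) ^ (m + 2) +
      (m + 2 : ℕ) * ((m + 2 : ℕ) * (2 ^ d * unitBallVolume d * momentConst d c m (N + 1)))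

lemma momentConst_ne_top {d : ℕ} {c : ℕ → ℝ≥0∞} (hc : ∀ p, c p ≠ ∞) (m N : ℕ) :
    momentConst d c m N ≠ ∞ := by
  induction m generalizing N with
  | zero => exact hc N
  | succ m ih =>
    rw [momentConst]
    refine ENNReal.add_ne_top.2 ⟨ENNReal.pow_ne_top (ENNReal.sum_ne_top.2 fun q _ => hc q), ?_⟩
    exact ENNReal.mul_ne_top (by simp) (ENNReal.mul_ne_top (by simp) (ENNReal.mul_ne_top
      (ENNReal.mul_ne_top (by simp) (unitBallVolume_ne_top d)) (ih _)))

/-- The sum `V ^ m * l ^ N + V ^ (m - 1) * l ^ (N + 1) + … + V * l ^ (N + m - 1)`. -/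
noncomputable def momentSum (V l : ℝ≥0∞) (m N : ℕ) : ℝ≥0∞ :=
  ∑ k ∈ Finset.range m, V ^ (m - k) * l ^ (k + N)

lemma momentSum_succ (V l : ℝ≥0∞) (m N : ℕ) :
    momentSum V l (m + 1) N = V ^ (m + 1) * l ^ N + momentSum V l m (N + 1) := by
  rw [momentSum, Finset.sum_range_succ', add_comm, momentSum]
  congr 1
  · simp
  · refine Finset.sum_congr rfl fun k _ => ?_
    congr 2 <;> omega

section Moments

variable {d : ℕ} {Ω : Type*} [MeasurableSpace Ω] {P : Measure Ω}
    [IsProbabilityMeasure P] {X : Ω → Space d → ℝ≥0∞} {V l : ℝ≥0∞} {c : ℕ → ℝ≥0∞}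
    (hX : Measurable fun y : Ω × Space d => X y.1 y.2) (hdec : DecouplesOnSeparated P X)
    (hI : ∀ p, ∫⁻ ω, (∫⁻ z, finitePow d p (X ω z)) ∂P ≤ c p * V * l ^ p)
include hX hI

omit hX [IsProbabilityMeasure P] in
lemma prod_lintegral_le {m N : ℕ} (p : Fin m → ℕ) (hp : ∑ k, p k = N) :
    ∏ k, ∫⁻ ω, (∫⁻ z, finitePow d (p k) (X ω z)) ∂P ≤
      (∑ q ∈ Finset.range (N + 1), c q) ^ m * (V ^ m * l ^ N) := by
  calc _ ≤ ∏ k, c (p k) * V * l ^ (p k) := Finset.prod_le_prod' fun k _ => hI _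
    _ = (∏ k, c (p k)) * (V ^ m * l ^ N) := by
      simp only [Finset.prod_mul_distrib, Finset.prod_const, Finset.card_univ, Fintype.card_fin,
        Finset.prod_pow_eq_pow_sum, hp]
      ring
    _ ≤ _ := by
      gcongr
      refine (Finset.prod_le_pow_card Finset.univ (fun k => c (p k))
        (∑ q ∈ Finset.range (N + 1), c q) fun k _ => ?_).trans_eq (by simp)
      refine Finset.single_le_sum (f := c) (fun _ _ => zero_le) ?_
      rw [Finset.mem_range, Nat.lt_succ_iff, ← hp]
      exact Finset.single_le_sum (fun _ _ => Nat.zero_le _) (Finset.mem_univ k)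

lemma separatedMoment_pi_le {m N : ℕ} (p : Fin m → ℕ) (hp : ∑ k, p k = N) :
    separatedMoment (Measure.pi fun _ : Fin m => P) (fun ω k => X (ω k)) p ≤
      (∑ q ∈ Finset.range (N + 1), c q) ^ m * (V ^ m * l ^ N) := by
  have hX' : ∀ k, Measurable fun y : (Fin m → Ω) × Space d => X (y.1 k) y.2 := fun k =>
    measurable_radius_coord hX k
  refine le_trans ?_ (prod_lintegral_le hI p hp)
  rw [← lintegral_pi_prod_finitePow hX,
    lintegral_prod_eq_separated_add_meeting (x := fun (ω : Fin m → Ω) k => X (ω k)) hX' p]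
  exact le_self_add

/-- For independent copies one merge suffices: the remaining moment is a product of one-point
moments, so no induction is needed. The copy attached to `j` no longer occurs and integrates to 1.
-/
lemma meetingMoment_pi_zero_le (m : ℕ) :
    meetingMoment (Measure.pi fun _ : Fin (m + 1) => P) (fun ω k => X (ω k)) 0 ≤
      (m + 1 : ℕ) * ((m + 1 : ℕ) *
      (2 ^ d * unitBallVolume d * (c 0 + c 1) ^ m)) * momentSum V l m 1 := by
  have hX' : ∀ k, Measurable fun y : (Fin (m + 1) → Ω) × Space d => X (y.1 k) y.2 := fun k =>
    measurable_radius_coord hX k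
  refine (meetingMoment_le hX' _).trans ?_
  calc _ ≤ ∑ i : Fin (m + 1), ∑ j : Fin (m + 1), 2 ^ d * unitBallVolume d *
        ((c 0 + c 1) ^ m * momentSum V l m 1) := by
        refine Finset.sum_le_sum fun i _ => Finset.sum_le_sum fun j _ => ?_
        split_ifs with hij
        swap
        · exact zero_le
        gcongr
        have hp : ∑ k, mergeExponents (0 : Fin (m + 1) → ℕ) i j k = 1 := by
          rw [sum_mergeExponents 0 hij]; simp
        have h := measurePreserving_piFinSuccAbove (fun _ : Fin (m + 1) => P) j
        have hm : Measurable fun ω : Fin m → Ω => ∏ k, ∫⁻ z, finitePow d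
            (mergeExponents (0 : Fin (m + 1) → ℕ) i j k) (X (ω k) z) :=
          Finset.measurable_prod _ fun k _ => Measurable.lintegral_prod_right'
            (f := fun y : (Fin m → Ω) × Space d => finitePow d
              (mergeExponents (0 : Fin (m + 1) → ℕ) i j k) (X (y.1 k) y.2))
            ((measurable_finitePow d _).comp (measurable_radius_coord hX k))
        calc _ = ∫⁻ ω : Ω × (Fin m → Ω), ∏ k, (∫⁻ z, finitePow d
              (mergeExponents (0 : Fin (m + 1) → ℕ) i j k) (X (ω.2 k) z))
                ∂(P.prod (Measure.pi fun _ => P)) :=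
              h.lintegral_comp_emb (MeasurableEquiv.measurableEmbedding _)
                (fun ω : Ω × (Fin m → Ω) => ∏ k, ∫⁻ z, finitePow d
              (mergeExponents (0 : Fin (m + 1) → ℕ) i j k) (X (ω.2 k) z))
          _ = ∏ k, ∫⁻ ω, (∫⁻ z, finitePow d
              (mergeExponents (0 : Fin (m + 1) → ℕ) i j k) (X ω z)) ∂P := by
              rw [← lintegral_pi_prod_finitePow hX]
              exact measurePreserving_snd.lintegral_comp hm
          _ ≤ _ := prod_lintegral_le hI _ hp
          _ ≤ _ := by
              rw [Finset.sum_range_succ, Finset.sum_range_one]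
              gcongr
              -- A single point has no partner; otherwise `V ^ m * l` is the leading term of the
              -- sum.
              obtain _ | m := m
              · exact absurd (Subsingleton.elim (α := Fin 1) i j) hij
              · rw [momentSum_succ]
                exact le_self_add
    _ = _ := by
        simp only [Finset.sum_const, Finset.card_univ, Fintype.card_fin, nsmul_eq_mul]
        ring

include hdec

/-- The disjoint part is at most the corresponding product of one-point moments and yields the
leading term of `momentSum`. The meeting part is at most (number of pairs) times a moment with one
point fewer and total exponent `N + 1`, covered by the induction hypothesis. `momentConst` and
`momentSum_succ` mirror this recursion. -/
theorem lintegral_prod_finitePow_le (m : ℕ) {N : ℕ} (p : Fin (m + 1) → ℕ) (hp : ∑ k, p k = N) :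
    ∫⁻ ω, ∏ k, (∫⁻ z, finitePow d (p k) (X ω z)) ∂P ≤
      momentConst d c m N * momentSum V l (m + 1) N := by
  induction m generalizing N with
  | zero =>
    simp only [Fin.prod_univ_succ, Fin.sum_univ_succ, Finset.univ_eq_empty, Finset.prod_empty,
      Finset.sum_empty, mul_one, add_zero] at hp ⊢
    subst hp
    simpa [momentConst, momentSum, mul_assoc] using hI (p 0)
  | succ m ih =>
    rw [lintegral_prod_eq_separated_add_meeting (x := fun ω _ => X ω) (fun _ => hX) p,
      separatedMoment_eq_pi hX hdec, momentSum_succ, momentConst]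
    have h1 := separatedMoment_pi_le hX hI p hp
    have h2 : meetingMoment P (fun ω _ => X ω) p ≤ (m + 2 : ℕ) * ((m + 2 : ℕ) *
        (2 ^ d * unitBallVolume d * momentConst d c m (N + 1))) *
          momentSum V l (m + 1) (N + 1) := by
      refine (meetingMoment_le (fun _ => hX) p).trans ?_
      calc _ ≤ ∑ i : Fin (m + 2), ∑ j : Fin (m + 2), 2 ^ d * unitBallVolume d *
            (momentConst d c m (N + 1) * momentSum V l (m + 1) (N + 1)) := by
            refine Finset.sum_le_sum fun i _ => Finset.sum_le_sum fun j _ => ?_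
            split_ifs with hij
            · gcongr
              exact ih _ (by rw [sum_mergeExponents p hij, hp])
            · exact zero_le
        _ = _ := by
            simp only [Finset.sum_const, Finset.card_univ, Fintype.card_fin, nsmul_eq_mul]
            ring
    refine (add_le_add h1 h2).trans ?_
    rw [add_mul]
    gcongr
    · exact le_self_add
    · exact le_add_self

lemma meetingMoment_zero_le (m : ℕ) :
    meetingMoment P (fun ω (_ : Fin (m + 1)) => X ω) 0 ≤ (m + 1 : ℕ) * ((m + 1 : ℕ) *
      (2 ^ d * unitBallVolume d * momentConst d c (m - 1) 1)) * momentSum V l m 1 := by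
  refine (meetingMoment_le (fun _ => hX) _).trans ?_
  calc _ ≤ ∑ i : Fin (m + 1), ∑ j : Fin (m + 1), 2 ^ d * unitBallVolume d *
        (momentConst d c (m - 1) 1 * momentSum V l m 1) := by
        refine Finset.sum_le_sum fun i _ => Finset.sum_le_sum fun j _ => ?_
        split_ifs with hij
        · gcongr
          -- With one point there are no pairs, so the truncated `m - 1` is harmless.
          obtain _ | m := m
          · exact absurd (Subsingleton.elim (α := Fin 1) i j) hij
          · exact lintegral_prod_finitePow_le hX hdec hI m _ (by
              rw [sum_mergeExponents 0 hij]; simp)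
        · exact zero_le
    _ = _ := by
        simp only [Finset.sum_const, Finset.card_univ, Fintype.card_fin, nsmul_eq_mul]
        ring

/-- The `(m + 1)`-st moment of the volume of `{z | X z < ∞}` and the `(m + 1)`-st power of its
mean differ by overlap terms only. -/
theorem exists_moment_decomposition (hV : ∫⁻ ω, (∫⁻ z, finitePow d 0 (X ω z)) ∂P = V) (m : ℕ) :
    ∃ a b₁ b₂ : ℝ≥0∞, ∫⁻ ω, (∫⁻ z, finitePow d 0 (X ω z)) ^ (m + 1) ∂P = a + b₁ ∧
      V ^ (m + 1) = a + b₂ ∧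
      b₁ ≤ (m + 1 : ℕ) * ((m + 1 : ℕ) *
        (2 ^ d * unitBallVolume d * momentConst d c (m - 1) 1)) * momentSum V l m 1 ∧
      b₂ ≤ (m + 1 : ℕ) * ((m + 1 : ℕ) *
        (2 ^ d * unitBallVolume d * (c 0 + c 1) ^ m)) * momentSum V l m 1 := by
  have hX' : ∀ k, Measurable fun y : (Fin (m + 1) → Ω) × Space d => X (y.1 k) y.2 := fun k =>
    measurable_radius_coord hX k
  -- The common term is the disjoint part, the same for X and for independent copies; the two
  -- remainders are the meeting parts.
  refine ⟨separatedMoment P (fun ω (_ : Fin (m + 1)) => X ω) 0, _, _, ?_, ?_,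
    meetingMoment_zero_le hX hdec hI m, meetingMoment_pi_zero_le hX hI m⟩
  · rw [← lintegral_prod_eq_separated_add_meeting (x := fun ω (_ : Fin (m + 1)) => X ω)
      (fun _ => hX)]
    simp
  · rw [separatedMoment_eq_pi hX hdec, ← lintegral_prod_eq_separated_add_meeting
      (x := fun (ω : Fin (m + 1) → Ω) k => X (ω k)) hX', lintegral_pi_prod_finitePow hX]
    simp [hV]

end Moments

/-! ### Void events, independence and locality of the nearest distance -/

/-- The event that the process has no point in `K`. -/
def voidEvent {d : ℕ} {Ω : Type*} (η : Ω → Set (Space d)) (K : Set (Space d)) : Set Ω :=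
  {ω | η ω ∩ K = ∅}

/-- The void events of the measurable subsets of `B`. -/
def voidEvents {d : ℕ} {Ω : Type*} (η : Ω → Set (Space d)) (B : Set (Space d)) : Set (Set Ω) :=
  {E | ∃ K, K ⊆ B ∧ MeasurableSet K ∧ E = voidEvent η K}

/-- The `σ`-algebra generated by the void events of the measurable subsets of `B`. -/
@[reducible] def voidSigma {d : ℕ} {Ω : Type*} (η : Ω → Set (Space d)) (B : Set (Space d)) :
    MeasurableSpace Ω :=
  MeasurableSpace.generateFrom (voidEvents η B)

lemma isPiSystem_voidEvents {d : ℕ} {Ω : Type*} (η : Ω → Set (Space d)) (B : Set (Space d)) :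
    IsPiSystem (voidEvents η B) := by
  rintro _ ⟨K, hKB, hK, rfl⟩ _ ⟨L, hLB, hL, rfl⟩ -
  refine ⟨K ∪ L, Set.union_subset hKB hLB, hK.union hL, ?_⟩
  ext ω
  simp [voidEvent, Set.inter_union_distrib_left]

lemma voidEvent_eq_preimage {d : ℕ} {Ω : Type*} (η : Ω → Set (Space d)) (K : Set (Space d)) :
    voidEvent η K = (fun ω => pointCount (η ω) K) ⁻¹' {0} := by
  ext ω
  simp [voidEvent, pointCount]

/-- Tails of distances are void events. Measurability, independence and the laws of distances are
all obtained from void events through this identity. -/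
lemma setOf_le_infEDist_eq {d : ℕ} {Ω : Type*} (η : Ω → Set (Space d)) (K : Set (Space d))
    (z : Space d) (r : ℝ≥0∞) :
    {ω | r ≤ Metric.infEDist z (η ω ∩ K)} = voidEvent η (K ∩ Metric.eball z r) := by
  ext ω
  simp only [Set.mem_ofPred_eq, Metric.le_infEDist, voidEvent, Set.eq_empty_iff_forall_notMem,
    Set.mem_inter_iff, Metric.mem_eball, not_and, not_lt, edist_comm z]
  grind

lemma measurable_voidSigma_infEDist {d : ℕ} {Ω : Type*} (η : Ω → Set (Space d))
    {K B : Set (Space d)} (hK : MeasurableSet K) (hKB : K ⊆ B) (z : Space d) :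
    Measurable[voidSigma η B] fun ω => Metric.infEDist z (η ω ∩ K) := by
  refine @measurable_of_Ici _ _ _ _ _ (voidSigma η B) _ _ _ _ fun r => ?_
  refine MeasurableSpace.measurableSet_generateFrom
    ⟨K ∩ Metric.eball z r, Set.inter_subset_left.trans hKB,
      hK.inter Metric.isOpen_eball.measurableSet, ?_⟩
  exact setOf_le_infEDist_eq η K z r

/-- The distance from `z` to the nearest point of `S` if this point lies in `A`, and `∞`
otherwise. -/
noncomputable def nearestDist {d : ℕ} (S A : Set (Space d)) (z : Space d) : ℝ≥0∞ :=
  if Metric.infEDist z (S ∩ A) ≤ Metric.infEDist z (S ∩ Aᶜ) then Metric.infEDist z (S ∩ A) else ∞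

lemma infEDist_inter_eball {d : ℕ} (T : Set (Space d)) (z : Space d) (q : ℝ≥0∞) :
    Metric.infEDist z T ≤ Metric.infEDist z (T ∩ Metric.eball z q) ∧
    (Metric.infEDist z T < q → Metric.infEDist z (T ∩ Metric.eball z q) = Metric.infEDist z T) ∧
    min q (Metric.infEDist z (T ∩ Metric.eball z q)) ≤ Metric.infEDist z T := by
  have h1 : Metric.infEDist z T ≤ Metric.infEDist z (T ∩ Metric.eball z q) :=
    Metric.infEDist_anti Set.inter_subset_left
  have h2 : min q (Metric.infEDist z (T ∩ Metric.eball z q)) ≤ Metric.infEDist z T := by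
    rw [Metric.le_infEDist]
    intro y hy
    by_cases hq : edist z y < q
    · refine (min_le_right _ _).trans (Metric.infEDist_le_edist_of_mem ⟨hy, ?_⟩)
      rwa [Metric.mem_eball, edist_comm]
    · exact (min_le_left _ _).trans (not_lt.1 hq)
  refine ⟨h1, fun h => le_antisymm ?_ h1, h2⟩
  rcases min_le_iff.1 h2 with h3 | h3
  · exact absurd h (not_lt.2 h3)
  · exact h3

/-- Points at distance at least `q` cannot affect a value below `q`. Allowing either side to be
below `q` makes the two events coincide, as comparing laws on a box requires. -/
lemma nearestDist_inter_eball {d : ℕ} (S A : Set (Space d)) (z : Space d) {q : ℝ≥0∞}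
    (h : nearestDist S A z < q ∨ nearestDist (S ∩ Metric.eball z q) A z < q) :
    nearestDist (S ∩ Metric.eball z q) A z = nearestDist S A z := by
  obtain ⟨a1, a2, a3⟩ := infEDist_inter_eball (S ∩ A) z q
  obtain ⟨b1, b2, b3⟩ := infEDist_inter_eball (S ∩ Aᶜ) z q
  simp only [nearestDist] at h ⊢
  rw [Set.inter_right_comm S _ A, Set.inter_right_comm S _ Aᶜ] at h ⊢
  generalize Metric.infEDist z (S ∩ A) = x at *
  generalize Metric.infEDist z (S ∩ Aᶜ) = y at *
  generalize Metric.infEDist z (S ∩ A ∩ Metric.eball z q) = x' at *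
  generalize Metric.infEDist z (S ∩ Aᶜ ∩ Metric.eball z q) = y' at *
  rcases h with h | h
  · split_ifs at h with hxy
    · rw [if_pos hxy, a2 h, if_pos (hxy.trans b1)]
    · exact absurd h not_top_lt
  · split_ifs at h with hxy
    · have hx : x' = x := a2 (a1.trans_lt h)
      have hy : x ≤ y := by
        rcases min_le_iff.1 b3 with h3 | h3
        · exact (a1.trans_lt h).le.trans h3
        · exact a1.trans (hxy.trans h3)
      rw [if_pos hxy, if_pos hy, hx]
    · exact absurd h not_top_lt

lemma measurable_voidSigma_nearestDist {d : ℕ} {Ω : Type*} (η : Ω → Set (Space d))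
    {A B : Set (Space d)} (hA : MeasurableSet A) (hB : MeasurableSet B) (z : Space d) :
    Measurable[voidSigma η B] fun ω => nearestDist (η ω ∩ B) A z := by
  have h1 := measurable_voidSigma_infEDist η (hB.inter hA) Set.inter_subset_left z
  have h2 := measurable_voidSigma_infEDist η (hB.inter hA.compl) Set.inter_subset_left z
  simp only [nearestDist, Set.inter_assoc]
  let : MeasurableSpace Ω := voidSigma η B
  exact Measurable.ite (measurableSet_le h1 h2) h1 measurable_const

namespace IsPoissonProcess

variable {d : ℕ} {Ω : Type*} [MeasurableSpace Ω] {P : Measure Ω} {lam : ℝ}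
  {η : Ω → Set (Space d)}

lemma measurableSet_voidEvent (hη : IsPoissonProcess P lam η) {K : Set (Space d)}
    (hK : MeasurableSet K) : MeasurableSet (voidEvent η K) := by
  rw [voidEvent_eq_preimage]
  exact hη.measurable_count K hK (measurableSet_singleton 0)

lemma voidSigma_le (hη : IsPoissonProcess P lam η) (B : Set (Space d)) :
    voidSigma η B ≤ ‹MeasurableSpace Ω› := by
  refine MeasurableSpace.generateFrom_le ?_
  rintro _ ⟨K, -, hK, rfl⟩
  exact hη.measurableSet_voidEvent hK

lemma measurable_infEDist (hη : IsPoissonProcess P lam η) {K : Set (Space d)}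
    (hK : MeasurableSet K) (z : Space d) :
    Measurable fun ω => Metric.infEDist z (η ω ∩ K) :=
  (measurable_voidSigma_infEDist η hK subset_rfl z).mono (hη.voidSigma_le K) le_rfl

lemma measurable_uncurry_infEDist (hη : IsPoissonProcess P lam η) {K : Set (Space d)}
    (hK : MeasurableSet K) : Measurable (Function.uncurry fun (z : Space d) (ω : Ω) =>
      Metric.infEDist z (η ω ∩ K)) :=
  measurable_uncurry_of_continuous_of_measurable
    (fun _ => Metric.continuous_infEDist) fun z => hη.measurable_infEDist hK z

lemma measurable_infEDist_prod (hη : IsPoissonProcess P lam η) {K : Set (Space d)}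
    (hK : MeasurableSet K) :
    Measurable fun y : Ω × Space d => Metric.infEDist y.2 (η y.1 ∩ K) := by
  have h := (hη.measurable_uncurry_infEDist hK).comp (measurable_swap (α := Ω) (β := Space d))
  exact h

lemma measurable_nearestDist_prod (hη : IsPoissonProcess P lam η) {A : Set (Space d)}
    (hA : MeasurableSet A) :
    Measurable fun y : Ω × Space d => nearestDist (η y.1) A y.2 :=
  Measurable.ite (measurableSet_le (hη.measurable_infEDist_prod hA)
    (hη.measurable_infEDist_prod hA.compl)) (hη.measurable_infEDist_prod hA) measurable_const

lemma measurable_nearestDist (hη : IsPoissonProcess P lam η) {A : Set (Space d)}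
    (hA : MeasurableSet A) (z : Space d) : Measurable fun ω => nearestDist (η ω) A z :=
  Measurable.ite (measurableSet_le (hη.measurable_infEDist hA z)
    (hη.measurable_infEDist hA.compl z)) (hη.measurable_infEDist hA z) measurable_const

/-- Void events form a π-system, so independence of the zero counts on disjoint sets extends to the
generated σ-algebras. -/
lemma iIndep_voidSigma (hη : IsPoissonProcess P lam η) {m : ℕ} {B : Fin m → Set (Space d)}
    (hB : Pairwise fun i j => Disjoint (B i) (B j)) :
    iIndep (fun i => voidSigma η (B i)) P := by
  refine iIndepSets.iIndep (fun i => hη.voidSigma_le (B i)) (fun i => voidEvents η (B i))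
    (fun i => isPiSystem_voidEvents η (B i)) (fun i => rfl) ?_
  rw [iIndepSets_iff]
  intro s f hf
  -- Indices outside `s` get the empty set, so that `indep_count` applies to the whole family.
  have hf' : ∀ i, ∃ K, K ⊆ B i ∧ MeasurableSet K ∧ (i ∈ s → f i = voidEvent η K) := by
    intro i
    by_cases hi : i ∈ s
    · obtain ⟨K, h1, h2, h3⟩ := hf i hi
      exact ⟨K, h1, h2, fun _ => h3⟩
    · exact ⟨∅, Set.empty_subset _, MeasurableSet.empty, fun h => absurd h hi⟩
  choose K hKB hK hfK using hf'
  have h := hη.indep_count m K hK fun i j hij => (hB hij).mono (hKB i) (hKB j)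
  have h1 := h.measure_inter_preimage_eq_mul s (sets := fun _ => {0})
    fun i _ => measurableSet_singleton _
  simp_rw [← voidEvent_eq_preimage] at h1
  rw [Set.iInter₂_congr hfK, h1]
  exact Finset.prod_congr rfl fun i hi => by rw [hfK i hi]

lemma iIndepFun_of_voidSigma (hη : IsPoissonProcess P lam η) {m : ℕ} {B : Fin m → Set (Space d)}
    (hB : Pairwise fun i j => Disjoint (B i) (B j)) {f : Fin m → Ω → ℝ≥0∞}
    (hf : ∀ i, Measurable[voidSigma η (B i)] (f i)) : iIndepFun f P := by
  rw [iIndepFun_iff_iIndep]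
  exact iIndep_of_iIndep_of_le (hη.iIndep_voidSigma hB) fun i => (hf i).comap_le

lemma indepFun_infEDist (hη : IsPoissonProcess P lam η) {K L : Set (Space d)}
    (hK : MeasurableSet K) (hL : MeasurableSet L) (hKL : Disjoint K L) (z : Space d) :
    IndepFun (fun ω => Metric.infEDist z (η ω ∩ K)) (fun ω => Metric.infEDist z (η ω ∩ L)) P := by
  have h := hη.iIndepFun_of_voidSigma (B := ![K, L])
    (f := ![fun ω => Metric.infEDist z (η ω ∩ K), fun ω => Metric.infEDist z (η ω ∩ L)]) ?_ ?_
  · exact h.indepFun (i := 0) (j := 1) (by simp)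
  · intro i j hij
    fin_cases i <;> fin_cases j <;> simp_all [hKL.symm]
  · intro i
    fin_cases i
    · exact measurable_voidSigma_infEDist η hK subset_rfl z
    · exact measurable_voidSigma_infEDist η hL subset_rfl z

end IsPoissonProcess

/-! ### Decoupling of the radii on disjoint balls -/

/-- The set of separated radii is a countable union of boxes. -/
lemma separatedRadii_eq_iUnion {d m : ℕ} (z : Fin m → Space d) :
    separatedRadii z = ⋃ q : {q : Fin m → ℚ // ∀ i j, i ≠ j →
      (((q i : ℝ).toNNReal : ℝ≥0∞) + ((q j : ℝ).toNNReal : ℝ≥0∞)) ≤ edist (z i) (z j)},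
      Set.univ.pi fun i => Set.Iio (((q.1 i : ℝ).toNNReal : ℝ≥0∞)) := by
  ext r
  simp only [Set.mem_iUnion, Set.mem_univ_pi, Set.mem_Iio, Subtype.exists, exists_prop]
  constructor
  · rintro ⟨hfin, hr⟩
    -- Strict inequalities leave room for a common enlargement ε of all radii; the rational corner
    -- of the box is taken between `r i` and `r i + ε`.
    have h1 : ∀ i j, i ≠ j → ∀ᶠ ε : ℝ≥0∞ in nhdsWithin 0 (Set.Ioi 0),
        r i + ε + (r j + ε) < edist (z i) (z j) := by
      intro i j hij
      have hc : Filter.Tendsto (fun ε : ℝ≥0∞ => r i + ε + (r j + ε)) (nhds 0)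
          (nhds (r i + 0 + (r j + 0))) := by
        have : Continuous fun ε : ℝ≥0∞ => r i + ε + (r j + ε) := by fun_prop
        exact this.tendsto 0
      rw [add_zero, add_zero] at hc
      exact (hc.mono_left nhdsWithin_le_nhds).eventually_lt_const (hr i j hij)
    have h2 : ∀ᶠ ε : ℝ≥0∞ in nhdsWithin 0 (Set.Ioi 0), ∀ i j, i ≠ j →
        r i + ε + (r j + ε) < edist (z i) (z j) := by
      simp only [Filter.eventually_all]
      exact h1
    obtain ⟨ε, h3, h4⟩ := (h2.and self_mem_nhdsWithin).exists
    have h5 : ∀ i, ∃ q : ℚ, r i < ((q : ℝ).toNNReal : ℝ≥0∞) ∧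
        ((q : ℝ).toNNReal : ℝ≥0∞) < r i + ε := by
      intro i
      obtain ⟨q, -, hq⟩ := ENNReal.lt_iff_exists_rat_btwn.1
        (ENNReal.lt_add_right (hfin i).ne (ne_of_gt h4))
      exact ⟨q, hq⟩
    choose q hq hq' using h5
    exact ⟨q, fun i j hij => (add_le_add (hq' i).le (hq' j).le).trans (h3 i j hij).le, hq⟩
  · rintro ⟨q, hq, hr⟩
    exact ⟨fun i => (hr i).trans ENNReal.coe_lt_top, fun i j hij =>
      (ENNReal.add_lt_add (hr i) (hr j)).trans_le (hq i j hij)⟩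

/-- The open balls of radius `r i` are disjoint, so the nearest distances computed from the points
inside them are independent. On the box they agree with the true ones, jointly (`h1`) and marginally
(`h2`), and restricting a product law to a box restricts each factor. -/
lemma IsPoissonProcess.restrict_box_eq {d : ℕ} {Ω : Type*} [MeasurableSpace Ω]
    {P : Measure Ω} [IsProbabilityMeasure P] {lam : ℝ} {η : Ω → Set (Space d)}
    (hη : IsPoissonProcess P lam η) {A : Set (Space d)} (hA : MeasurableSet A) {m : ℕ}
    (z : Fin m → Space d) (r : Fin m → ℝ≥0∞)
    (hq : ∀ i j, i ≠ j → r i + r j ≤ edist (z i) (z j)) :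
    (P.map fun ω k => nearestDist (η ω) A (z k)).restrict
        (Set.univ.pi fun i => Set.Iio (r i)) =
      (Measure.pi fun k => P.map fun ω => nearestDist (η ω) A (z k)).restrict
        (Set.univ.pi fun i => Set.Iio (r i)) := by
  let B : Fin m → Set (Space d) := fun i => Metric.eball (z i) (r i)
  have hB : ∀ i, MeasurableSet (B i) := fun i => Metric.isOpen_eball.measurableSet
  have hdisj : Pairwise fun i j => Disjoint (B i) (B j) := fun i j hij =>
    Metric.eball_disjoint (hq i j hij)
  have hX : ∀ i, Measurable fun ω => nearestDist (η ω) A (z i) := fun i =>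
    hη.measurable_nearestDist hA (z i)
  have hY' := fun i => measurable_voidSigma_nearestDist η hA (hB i) (z i)
  have hY : ∀ i, Measurable fun ω => nearestDist (η ω ∩ B i) A (z i) := fun i =>
    (hY' i).mono (hη.voidSigma_le (B i)) le_rfl
  have hind := hη.iIndepFun_of_voidSigma hdisj hY'
  rw [iIndepFun_iff_map_fun_eq_pi_map fun i => (hY i).aemeasurable] at hind
  have hXY : ∀ i ω, nearestDist (η ω) A (z i) < r i ∨ nearestDist (η ω ∩ B i) A (z i) < r i →
      nearestDist (η ω ∩ B i) A (z i) = nearestDist (η ω) A (z i) :=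
    fun i ω h => nearestDist_inter_eball _ _ _ h
  have hbox : MeasurableSet (Set.univ.pi fun i => Set.Iio (r i)) :=
    MeasurableSet.univ_pi fun i => measurableSet_Iio
  have h1 : (P.map fun ω k => nearestDist (η ω) A (z k)).restrict
      (Set.univ.pi fun i => Set.Iio (r i)) =
      (P.map fun ω k => nearestDist (η ω ∩ B k) A (z k)).restrict
        (Set.univ.pi fun i => Set.Iio (r i)) := by
    ext s hs
    rw [Measure.restrict_apply hs, Measure.restrict_apply hs,
      Measure.map_apply (measurable_pi_lambda _ hX) (hs.inter hbox),
      Measure.map_apply (measurable_pi_lambda _ hY) (hs.inter hbox)]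
    congr 1
    ext ω
    simp only [Set.mem_preimage, Set.mem_inter_iff, Set.mem_univ_pi, Set.mem_Iio]
    constructor
    · rintro ⟨h, h'⟩
      have : (fun k => nearestDist (η ω ∩ B k) A (z k)) = fun k => nearestDist (η ω) A (z k) :=
        funext fun k => hXY k ω (Or.inl (h' k))
      exact ⟨by rwa [this], fun k => by rw [hXY k ω (Or.inl (h' k))]; exact h' k⟩
    · rintro ⟨h, h'⟩
      have : (fun k => nearestDist (η ω ∩ B k) A (z k)) = fun k => nearestDist (η ω) A (z k) :=
        funext fun k => hXY k ω (Or.inr (h' k))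
      exact ⟨by rwa [← this], fun k => by rw [← hXY k ω (Or.inr (h' k))]; exact h' k⟩
  have h2 : ∀ i, (P.map fun ω => nearestDist (η ω ∩ B i) A (z i)).restrict (Set.Iio (r i)) =
      (P.map fun ω => nearestDist (η ω) A (z i)).restrict (Set.Iio (r i)) := by
    intro i
    ext s hs
    rw [Measure.restrict_apply hs, Measure.restrict_apply hs,
      Measure.map_apply (hX i) (hs.inter measurableSet_Iio),
      Measure.map_apply (hY i) (hs.inter measurableSet_Iio)]
    congr 1
    ext ω
    simp only [Set.mem_preimage, Set.mem_inter_iff, Set.mem_Iio]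
    constructor
    · rintro ⟨h, h'⟩
      rw [← hXY i ω (Or.inr h')]
      exact ⟨h, h'⟩
    · rintro ⟨h, h'⟩
      rw [hXY i ω (Or.inl h')]
      exact ⟨h, h'⟩
  have h3 : ∀ i, IsProbabilityMeasure (P.map fun ω => nearestDist (η ω) A (z i)) := fun i =>
    Measure.isProbabilityMeasure_map (hX i).aemeasurable
  have h4 : ∀ i, IsProbabilityMeasure (P.map fun ω => nearestDist (η ω ∩ B i) A (z i)) := fun i =>
    Measure.isProbabilityMeasure_map (hY i).aemeasurable
  rw [h1, hind, Measure.restrict_pi_pi, Measure.restrict_pi_pi]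
  simp_rw [h2]

theorem IsPoissonProcess.decouplesOnSeparated {d : ℕ} {Ω : Type*} [MeasurableSpace Ω]
    {P : Measure Ω} [IsProbabilityMeasure P] {lam : ℝ} {η : Ω → Set (Space d)}
    (hη : IsPoissonProcess P lam η) {A : Set (Space d)} (hA : MeasurableSet A) :
    DecouplesOnSeparated P fun ω => nearestDist (η ω) A := by
  intro m z
  rw [separatedRadii_eq_iUnion, Measure.restrict_iUnion_congr]
  exact fun q => hη.restrict_box_eq hA z _ q.2

/-! ### The Voronoi approximation in terms of the nearest distance -/

lemma exists_edist_eq_infEDist {d : ℕ} {S : Set (Space d)}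
    (hS : ∀ B : Set (Space d), Bornology.IsBounded B → (S ∩ B).Finite) (A : Set (Space d))
    {z : Space d} (h : Metric.infEDist z (S ∩ A) < ∞) :
    ∃ x ∈ S ∩ A, edist z x = Metric.infEDist z (S ∩ A) := by
  obtain ⟨x₀, hx₀, -⟩ := Metric.infEDist_lt_iff.1 h
  have hfin : (S ∩ A ∩ Metric.closedBall z (dist x₀ z)).Finite :=
    (hS _ Metric.isBounded_closedBall).subset (by
      rintro y ⟨⟨h1, -⟩, h2⟩
      exact ⟨h1, h2⟩)
  obtain ⟨x, hx, hmin⟩ := Set.exists_min_image _ (fun y => edist z y) hfin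
    ⟨x₀, hx₀, Metric.mem_closedBall.2 le_rfl⟩
  refine ⟨x, hx.1, le_antisymm ?_ (Metric.infEDist_le_edist_of_mem hx.1)⟩
  rw [Metric.le_infEDist]
  intro y hy
  by_cases hyz : dist y z ≤ dist x₀ z
  · exact hmin y ⟨hy, hyz⟩
  · refine (hmin x₀ ⟨hx₀, Metric.mem_closedBall.2 le_rfl⟩).trans ?_
    rw [edist_comm z, edist_comm z, edist_dist, edist_dist]
    exact ENNReal.ofReal_le_ofReal (not_le.1 hyz).le

lemma nearestDist_lt_top_iff {d : ℕ} (S A : Set (Space d)) (z : Space d) :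
    nearestDist S A z < ∞ ↔ Metric.infEDist z (S ∩ A) ≤ Metric.infEDist z (S ∩ Aᶜ) ∧
      Metric.infEDist z (S ∩ A) < ∞ := by
  rw [nearestDist]
  split_ifs with h <;> simp [h]

lemma nearestDist_of_lt_top {d : ℕ} {S A : Set (Space d)} {z : Space d}
    (h : nearestDist S A z < ∞) : nearestDist S A z = Metric.infEDist z S ∧
      Metric.infEDist z (S ∩ A) = Metric.infEDist z S := by
  have h1 := ((nearestDist_lt_top_iff S A z).1 h).1
  have h2 : Metric.infEDist z S = Metric.infEDist z (S ∩ A) := by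
    conv_lhs => rw [← Set.inter_union_compl S A]
    rw [Metric.infEDist_union]
    exact min_eq_left h1
  rw [nearestDist, if_pos h1, h2]
  exact ⟨rfl, rfl⟩

/-- Local finiteness makes the infimum attained, so a nucleus exists. The non-strict comparison in
`nearestDist` matches the closed cells: ties count for A. -/
lemma mem_voronoiApprox_iff {d : ℕ} {S : Set (Space d)}
    (hS : ∀ B : Set (Space d), Bornology.IsBounded B → (S ∩ B).Finite) (A : Set (Space d))
    (z : Space d) : z ∈ voronoiApprox S A ↔ nearestDist S A z < ∞ := by
  have hn : ∀ x y : Space d, ‖z - x‖ ≤ ‖z - y‖ ↔ edist z x ≤ edist z y := fun x y => by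
    rw [edist_dist, edist_dist, ENNReal.ofReal_le_ofReal_iff dist_nonneg, dist_eq_norm,
      dist_eq_norm]
  simp only [nearestDist_lt_top_iff, voronoiApprox, voronoiCell, Set.mem_iUnion,
    Set.mem_ofPred_eq, exists_prop, hn]
  constructor
  · rintro ⟨x, hx, h⟩
    have h1 := Metric.infEDist_le_edist_of_mem (x := z) hx
    refine ⟨h1.trans ?_, h1.trans_lt (edist_lt_top z x)⟩
    rw [Metric.le_infEDist]
    exact fun y hy => h y hy.1
  · rintro ⟨h1, h2⟩
    obtain ⟨x, hx, hxz⟩ := exists_edist_eq_infEDist hS A h2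
    refine ⟨x, hx, fun y hy => ?_⟩
    rw [hxz]
    by_cases hyA : y ∈ A
    · exact Metric.infEDist_le_edist_of_mem ⟨hy, hyA⟩
    · exact h1.trans (Metric.infEDist_le_edist_of_mem ⟨hy, hyA⟩)

lemma voronoiApprox_iUnion {d : ℕ} {ι : Type*} (S : Set (Space d)) (A : ι → Set (Space d)) :
    voronoiApprox S (⋃ i, A i) = ⋃ i, voronoiApprox S (A i) := by
  ext z
  simp only [voronoiApprox, Set.mem_iUnion, Set.mem_inter_iff]
  grind

lemma finitePow_nearestDist {d p : ℕ} (S A : Set (Space d)) (z : Space d) :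
    finitePow d p (nearestDist S A z) =
      if nearestDist S A z < ∞ then Metric.infEDist z S ^ (d * p) else 0 := by
  rw [finitePow]
  split_ifs with h
  · rw [(nearestDist_of_lt_top h).1]
  · rfl

lemma finitePow_nearestDist_le {d p : ℕ} (S A : Set (Space d)) (z : Space d) :
    finitePow d p (nearestDist S A z) ≤ Metric.infEDist z S ^ (d * p) := by
  rw [finitePow_nearestDist]
  split_ifs
  · exact le_rfl
  · exact zero_le

/-! ### Void probabilities, stationarity and the one-point moments -/

namespace IsPoissonProcess

variable {d : ℕ} {Ω : Type*} [MeasurableSpace Ω] {P : Measure Ω} {lam : ℝ}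
  {η : Ω → Set (Space d)}

lemma measure_voidEvent (hη : IsPoissonProcess P lam η) {K : Set (Space d)}
    (hK : MeasurableSet K) (hvol : volume K ≠ ∞) :
    P (voidEvent η K) =
      ENNReal.ofReal (Real.exp (-((lam.toNNReal * (volume K).toNNReal : ℝ≥0) : ℝ))) := by
  have h := DFunLike.congr_fun (hη.law_count K hK hvol) {0}
  rw [Measure.map_apply (hη.measurable_count K hK) (measurableSet_singleton 0),
    ← voidEvent_eq_preimage, Measure.map_apply (by fun_prop) (measurableSet_singleton 0)] at h
  have h0 : (fun k : ℕ => (k : ℕ∞)) ⁻¹' {0} = {0} := by ext; simp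
  rw [h, h0, poissonMeasure_singleton]
  simp

lemma measure_voidEvent_eq_zero (hη : IsPoissonProcess P lam η) (hlam : 0 < lam)
    {K : Set (Space d)} (hK : MeasurableSet K) (hvol : volume K = ∞) :
    P (voidEvent η K) = 0 := by
  have h : ∀ n : ℕ, P (voidEvent η K) ≤ ENNReal.ofReal (Real.exp (-(lam * n))) := by
    intro n
    obtain ⟨T, hT, hTK, hn, hfin⟩ := Measure.exists_subset_measure_lt_top (r := n) hK
      (by rw [hvol]; exact ENNReal.natCast_lt_top n)
    calc P (voidEvent η K) ≤ P (voidEvent η T) := by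
          refine measure_mono fun ω hω => ?_
          exact Set.subset_eq_empty (Set.inter_subset_inter_right _ hTK) hω
      _ = _ := hη.measure_voidEvent hT hfin.ne
      _ ≤ _ := by
          refine ENNReal.ofReal_le_ofReal (Real.exp_le_exp.2 (neg_le_neg ?_))
          rw [NNReal.coe_mul, Real.coe_toNNReal _ hlam.le]
          gcongr
          have := ENNReal.toReal_mono hfin.ne hn.le
          rw [ENNReal.coe_toNNReal_eq_toReal]
          simpa only [ENNReal.toReal_natCast] using this
  have hlim : Filter.Tendsto (fun n : ℕ => ENNReal.ofReal (Real.exp (-(lam * n)))) Filter.atTop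
      (nhds 0) := by
    rw [← ENNReal.ofReal_zero]
    refine ENNReal.tendsto_ofReal (Real.tendsto_exp_neg_atTop_nhds_zero.comp ?_)
    exact tendsto_natCast_atTop_atTop.const_mul_atTop hlam
  exact le_antisymm (ge_of_tendsto' hlim h) zero_le

lemma measure_voidEvent_congr (hη : IsPoissonProcess P lam η) (hlam : 0 < lam)
    {K L : Set (Space d)} (hK : MeasurableSet K) (hL : MeasurableSet L)
    (h : volume K = volume L) : P (voidEvent η K) = P (voidEvent η L) := by
  by_cases hvol : volume K = ∞
  · rw [hη.measure_voidEvent_eq_zero hlam hK hvol,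
      hη.measure_voidEvent_eq_zero hlam hL (h ▸ hvol)]
  · rw [hη.measure_voidEvent hK hvol, hη.measure_voidEvent hL (h ▸ hvol), h]

variable [IsProbabilityMeasure P]

lemma measure_compl_voidEvent_eq_zero (hη : IsPoissonProcess P lam η) {K : Set (Space d)}
    (hK : MeasurableSet K) (hvol : volume K = 0) : P (voidEvent η K)ᶜ = 0 := by
  rw [prob_compl_eq_zero_iff (hη.measurableSet_voidEvent hK),
    hη.measure_voidEvent hK (by simp [hvol])]
  simp [hvol]

lemma map_infEDist_congr (hη : IsPoissonProcess P lam η) (hlam : 0 < lam)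
    {K L : Set (Space d)} (hK : MeasurableSet K) (hL : MeasurableSet L) {z w : Space d}
    (h : ∀ r, volume (K ∩ Metric.eball z r) = volume (L ∩ Metric.eball w r)) :
    P.map (fun ω => Metric.infEDist z (η ω ∩ K)) =
      P.map (fun ω => Metric.infEDist w (η ω ∩ L)) := by
  have h1 := Measure.isFiniteMeasure_map P fun ω => Metric.infEDist z (η ω ∩ K)
  refine Measure.ext_of_Ici _ _ fun r => ?_
  rw [Measure.map_apply (hη.measurable_infEDist hK z) measurableSet_Ici,
    Measure.map_apply (hη.measurable_infEDist hL w) measurableSet_Ici]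
  have h2 := fun (K : Set (Space d)) (z : Space d) => setOf_le_infEDist_eq η K z r
  calc _ = P (voidEvent η (K ∩ Metric.eball z r)) := congrArg P (h2 K z)
    _ = P (voidEvent η (L ∩ Metric.eball w r)) :=
      hη.measure_voidEvent_congr hlam (hK.inter Metric.isOpen_eball.measurableSet)
        (hL.inter Metric.isOpen_eball.measurableSet) (h r)
    _ = _ := (congrArg P (h2 L w)).symm

/-- Stationarity from void probabilities: the distances to the points in A and in its complement are
independent, and the law of each depends only on the volumes of the set within balls, which
translation preserves. -/
lemma lintegral_nearestDist_translate (hη : IsPoissonProcess P lam η) (hlam : 0 < lam)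
    {A : Set (Space d)} (hA : MeasurableSet A) (z : Space d) {φ : ℝ≥0∞ → ℝ≥0∞}
    (hφ : Measurable φ) :
    ∫⁻ ω, φ (nearestDist (η ω) A z) ∂P =
      ∫⁻ ω, φ (nearestDist (η ω) ((fun x => x + z) ⁻¹' A) 0) ∂P := by
  have hz : Measurable fun x : Space d => x + z := measurable_add_const z
  have hvol : ∀ (K : Set (Space d)) (r : ℝ≥0∞), volume (K ∩ Metric.eball z r) =
      volume ((fun x => x + z) ⁻¹' K ∩ Metric.eball 0 r) := by
    intro K r
    rw [← measure_preimage_add_right volume z (K ∩ Metric.eball z r)]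
    congr 1
    ext x
    simp [edist_eq_enorm_sub]
  let ψ : ℝ≥0∞ × ℝ≥0∞ → ℝ≥0∞ := fun y => φ (if y.1 ≤ y.2 then y.1 else ∞)
  have hψ : Measurable ψ := hφ.comp (Measurable.ite
    (measurableSet_le measurable_fst measurable_snd) measurable_fst measurable_const)
  have h : ∀ (K : Set (Space d)) (w : Space d), MeasurableSet K →
      ∫⁻ ω, φ (nearestDist (η ω) K w) ∂P = ∫⁻ y, ψ y
        ∂((P.map fun ω => Metric.infEDist w (η ω ∩ K)).prod
          (P.map fun ω => Metric.infEDist w (η ω ∩ Kᶜ))) := by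
    intro K w hK
    rw [← (indepFun_iff_map_prod_eq_prod_map_map (hη.measurable_infEDist hK w).aemeasurable
      (hη.measurable_infEDist hK.compl w).aemeasurable).1
      (hη.indepFun_infEDist hK hK.compl disjoint_compl_right w),
      lintegral_map hψ ((hη.measurable_infEDist hK w).prodMk
        (hη.measurable_infEDist hK.compl w))]
    rfl
  rw [h A z hA, h _ 0 (hz hA), hη.map_infEDist_congr hlam hA (hz hA) (hvol A),
    hη.map_infEDist_congr hlam hA.compl (hz hA.compl) (hvol Aᶜ)]
  rfl

/-- An attained distance `r` puts a point of η on a sphere, which is a null set in dimension at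
least 1. -/
lemma measure_infEDist_eq_zero (hη : IsPoissonProcess P lam η) (hd : 1 ≤ d) (K : Set (Space d))
    (z : Space d) {r : ℝ≥0∞} (hr : r < ∞) :
    P {ω | Metric.infEDist z (η ω ∩ K) = r} = 0 := by
  have : Nonempty (Fin d) := ⟨⟨0, hd⟩⟩
  refine measure_mono_null (fun ω hω => ?_) (hη.measure_compl_voidEvent_eq_zero
    Metric.isClosed_sphere.measurableSet (Measure.addHaar_sphere volume z r.toReal))
  have hω' : Metric.infEDist z (η ω ∩ K) = r := hω
  obtain ⟨x, hx, hxz⟩ := exists_edist_eq_infEDist (hη.locallyFinite ω) K (z := z)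
    (by rwa [hω'])
  rw [hω', edist_comm] at hxz
  have h2 : dist x z = r.toReal := by rw [← hxz, edist_dist, ENNReal.toReal_ofReal dist_nonneg]
  exact fun h : η ω ∩ Metric.sphere z r.toReal = ∅ => (h ▸ ⟨hx.1, h2⟩ : x ∈ (∅ : Set (Space d)))

/-- A tie means equal finite distances to the points in K and in L. These distances are independent
and have no finite atoms, so Fubini on the product law gives probability 0. -/
lemma ae_not_tie (hη : IsPoissonProcess P lam η) (hd : 1 ≤ d) {K L : Set (Space d)}
    (hK : MeasurableSet K) (hL : MeasurableSet L) (hKL : Disjoint K L) (z : Space d) :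
    ∀ᵐ ω ∂P, ¬ (nearestDist (η ω) K z < ∞ ∧ nearestDist (η ω) L z < ∞) := by
  let T : Set (ℝ≥0∞ × ℝ≥0∞) := {y | y.1 = y.2 ∧ y.2 < ∞}
  have hT : MeasurableSet T := (measurableSet_eq_fun measurable_fst measurable_snd).inter
    (measurableSet_lt measurable_snd measurable_const)
  have hDK := hη.measurable_infEDist hK z
  have hDL := hη.measurable_infEDist hL z
  have h := (indepFun_iff_map_prod_eq_prod_map_map hDK.aemeasurable hDL.aemeasurable).1
      (hη.indepFun_infEDist hK hL hKL z)
  have h0 : P ((fun ω => (Metric.infEDist z (η ω ∩ K), Metric.infEDist z (η ω ∩ L))) ⁻¹' T) = 0 := by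
    rw [← Measure.map_apply (hDK.prodMk hDL) hT, h, Measure.prod_apply_symm hT,
      lintegral_eq_zero_iff (measurable_measure_prodMk_right hT)]
    refine Filter.Eventually.of_forall fun y => ?_
    by_cases hy : y < ∞
    · have : (fun x => (x, y)) ⁻¹' T = {y} := by ext x; simp [T, hy]
      simp only [this, Pi.zero_apply]
      rw [Measure.map_apply hDK (measurableSet_singleton y)]
      exact hη.measure_infEDist_eq_zero hd K z hy
    · have : (fun x => (x, y)) ⁻¹' T = ∅ := by ext x; simp [T, hy]
      simp [this]
  refine measure_mono_null (fun ω hω => ?_) h0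
  obtain ⟨h1, h2⟩ := not_not.1 hω
  have h3 := nearestDist_of_lt_top h1
  have h4 := nearestDist_of_lt_top h2
  refine ⟨h3.2.trans h4.2.symm, ?_⟩
  exact ((nearestDist_lt_top_iff _ _ _).1 h2).2

/-- The law of the point nearest to the origin, weighted with a power of its norm, as a measure. -/
lemma exists_nearest_measure (hη : IsPoissonProcess P lam η) (hd : 1 ≤ d) (p : ℕ) :
    ∃ μ : Measure (Space d), ∀ A, MeasurableSet A →
      μ A = ∫⁻ ω, finitePow d p (nearestDist (η ω) A 0) ∂P := by
  refine ⟨Measure.ofMeasurable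
    (fun A _ => ∫⁻ ω, finitePow d p (nearestDist (η ω) A 0) ∂P) ?_ ?_, fun A hA =>
      Measure.ofMeasurable_apply A hA⟩
  · simp [nearestDist]
  · intro A hA hdisj
    refine Eq.trans ?_ (lintegral_tsum fun i =>
      ((measurable_finitePow d p).comp (hη.measurable_nearestDist (hA i) 0)).aemeasurable)
    -- Countable additivity: the approximation of a union is the union of the approximations, and
    -- almost surely no two of them contain the origin.
    have hties : ∀ᵐ ω ∂P, ∀ i j, i ≠ j →
        ¬ (nearestDist (η ω) (A i) 0 < ∞ ∧ nearestDist (η ω) (A j) 0 < ∞) := by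
      simp only [ae_all_iff]
      exact fun i j hij => hη.ae_not_tie hd (hA i) (hA j) (hdisj hij) 0
    refine lintegral_congr_ae ?_
    filter_upwards [hties] with ω hω
    have hmem := fun B => mem_voronoiApprox_iff (hη.locallyFinite ω) B 0
    simp only [finitePow_nearestDist]
    by_cases h : nearestDist (η ω) (⋃ i, A i) 0 < ∞
    · rw [if_pos h]
      rw [← hmem, voronoiApprox_iUnion, Set.mem_iUnion] at h
      obtain ⟨i, hi⟩ := h
      rw [hmem] at hi
      rw [tsum_eq_single i, if_pos hi]
      intro j hj
      exact if_neg fun h => hω j i hj ⟨h, hi⟩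
    · rw [if_neg h, eq_comm, ENNReal.tsum_eq_zero]
      intro i
      refine if_neg fun hi => h ?_
      rw [← hmem, voronoiApprox_iUnion]
      exact Set.mem_iUnion.2 ⟨i, (hmem _).2 hi⟩

/-- By stationarity the expectation at `z` is `μ (A - z)`, with `μ` the weighted law of the point
nearest to the origin. Tonelli then gives `volume A * μ univ`; `hfin` makes `μ` finite, as the
exchange requires. -/
lemma lintegral_finitePow_nearestDist (hη : IsPoissonProcess P lam η) (hd : 1 ≤ d)
    (hlam : 0 < lam) {A : Set (Space d)} (hA : MeasurableSet A) (p : ℕ)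
    (hfin : ∫⁻ ω, finitePow d p (nearestDist (η ω) Set.univ 0) ∂P ≠ ∞) :
    ∫⁻ ω, (∫⁻ z, finitePow d p (nearestDist (η ω) A z)) ∂P =
      volume A * ∫⁻ ω, finitePow d p (nearestDist (η ω) Set.univ 0) ∂P := by
  obtain ⟨μ, hμ⟩ := hη.exists_nearest_measure hd p
  have : IsFiniteMeasure μ := ⟨by rw [hμ _ MeasurableSet.univ]; exact hfin.lt_top⟩
  have hS : MeasurableSet {y : Space d × Space d | y.2 + y.1 ∈ A} :=
    (measurable_snd.add measurable_fst) hA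
  rw [lintegral_lintegral_swap (f := fun ω z => finitePow d p (nearestDist (η ω) A z))
    ((measurable_finitePow d p).comp (hη.measurable_nearestDist_prod hA)).aemeasurable]
  have h1 : ∀ z, ∫⁻ ω, finitePow d p (nearestDist (η ω) A z) ∂P =
      μ (Prod.mk z ⁻¹' {y : Space d × Space d | y.2 + y.1 ∈ A}) := by
    intro z
    rw [hη.lintegral_nearestDist_translate hlam hA z (measurable_finitePow d p),
      ← hμ _ (measurable_add_const z hA)]
    rfl
  simp_rw [h1]
  rw [← Measure.prod_apply hS, Measure.prod_apply_symm hS]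
  have h2 : ∀ x : Space d, volume ((fun z => (z, x)) ⁻¹'
      {y : Space d × Space d | y.2 + y.1 ∈ A}) = volume A := fun x =>
    measure_preimage_add volume x A
  simp_rw [h2]
  rw [lintegral_const, hμ _ MeasurableSet.univ]

omit [IsProbabilityMeasure P] in
lemma measurable_infEDist_self (hη : IsPoissonProcess P lam η) (z : Space d) :
    Measurable fun ω => Metric.infEDist z (η ω) := by
  simpa using hη.measurable_infEDist MeasurableSet.univ z

omit [IsProbabilityMeasure P] in
lemma measure_le_infEDist_pow (hη : IsPoissonProcess P lam η) (hd : 1 ≤ d) (hlam : 0 < lam)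
    (z : Space d) (k : ℕ) :
    P {ω | (k : ℝ≥0∞) ≤ ENNReal.ofReal lam * unitBallVolume d * Metric.infEDist z (η ω) ^ d} ≤
      ENNReal.ofReal (Real.exp (-k)) := by
  have hl0 : ENNReal.ofReal lam ≠ 0 := by simpa using hlam
  have ha0 : ENNReal.ofReal lam * unitBallVolume d ≠ 0 :=
    mul_ne_zero hl0 (unitBallVolume_ne_zero d)
  have hat : ENNReal.ofReal lam * unitBallVolume d ≠ ∞ :=
    ENNReal.mul_ne_top ENNReal.ofReal_ne_top (unitBallVolume_ne_top d)
  have hd0 : d ≠ 0 := by omega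
  -- The radius at which the ball contains `k` points on average, hence is empty with probability
  -- `exp (-k)`.
  obtain ⟨r, hr⟩ : ∃ r : ℝ≥0∞, r ^ d = k / (ENNReal.ofReal lam * unitBallVolume d) :=
    ⟨(k / (ENNReal.ofReal lam * unitBallVolume d)) ^ ((d : ℝ)⁻¹),
      ENNReal.rpow_inv_natCast_pow hd0 _⟩
  have hrt : r ≠ ∞ := by
    rintro rfl
    rw [ENNReal.top_pow hd0] at hr
    exact ENNReal.div_ne_top (ENNReal.natCast_ne_top k) ha0 hr.symm
  have hvol : volume (Metric.eball z r) = k / ENNReal.ofReal lam := by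
    lift r to ℝ≥0 using hrt
    have : Nonempty (Fin d) := ⟨⟨0, hd⟩⟩
    rw [Metric.eball_coe, ← Measure.addHaar_closedBall_eq_addHaar_ball, ← Metric.closedEBall_coe,
      volume_closedEBall _ (by simp), hr, ← ENNReal.mul_div_right_comm,
      ENNReal.mul_div_mul_right _ _ (unitBallVolume_ne_zero d) (unitBallVolume_ne_top d)]
  calc _ ≤ P (voidEvent η (Metric.eball z r)) := by
        refine measure_mono fun ω hω => ?_
        have hω' : r ≤ Metric.infEDist z (η ω) := by
          refine (ENNReal.pow_le_pow_left_iff hd0).1 ?_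
          rw [hr]
          exact ENNReal.div_le_of_le_mul' hω
        have h := setOf_le_infEDist_eq η Set.univ z r
        simp only [Set.inter_univ, Set.univ_inter] at h
        rw [← h]
        exact hω'
    _ = _ := by
        rw [hη.measure_voidEvent Metric.isOpen_eball.measurableSet (by
          rw [hvol]; exact ENNReal.div_ne_top (ENNReal.natCast_ne_top k) hl0), hvol]
        congr 3
        rw [NNReal.coe_mul, ENNReal.coe_toNNReal_eq_toReal, ENNReal.toReal_div,
          ENNReal.toReal_ofReal hlam.le, Real.coe_toNNReal _ hlam.le, ENNReal.toReal_natCast]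
        field_simp

end IsPoissonProcess

/-! ### Moments of the distance to the nearest point, and constants -/

/-- The series `∑ (k + 1) ^ p * exp (-k)`, which dominates the `p`-th moment of a random variable
with exponential tails. -/
noncomputable def expMoment (p : ℕ) : ℝ≥0∞ :=
  ∑' k : ℕ, ((k + 1 : ℕ) : ℝ≥0∞) ^ p * ENNReal.ofReal (Real.exp (-k))

lemma expMoment_ne_top (p : ℕ) : expMoment p ≠ ∞ := by
  have h1 : Summable fun k : ℕ => ((k + 1 : ℕ) : ℝ) ^ p * Real.exp (-k) := by
    have h := ((summable_nat_add_iff 1).2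
      (Real.summable_pow_mul_exp_neg_nat_mul p one_pos)).mul_right (Real.exp 1)
    refine h.congr fun k => ?_
    rw [mul_assoc, ← Real.exp_add]
    congr 2
    push_cast
    ring
  have h2 : expMoment p = ∑' k : ℕ, ENNReal.ofReal (((k + 1 : ℕ) : ℝ) ^ p * Real.exp (-k)) := by
    refine tsum_congr fun k => ?_
    rw [ENNReal.ofReal_mul (by positivity), ENNReal.ofReal_pow (by positivity),
      ENNReal.ofReal_natCast]
  rw [h2, ← ENNReal.ofReal_tsum_of_nonneg (fun k => by positivity) h1]
  exact ENNReal.ofReal_ne_top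

/-- The single term `k = ⌊t⌋` already dominates a finite `t`; for `t = ∞` every term is at least 1
and the series diverges. -/
lemma pow_le_tsum_indicator (t : ℝ≥0∞) (p : ℕ) :
    t ^ p ≤ ∑' k : ℕ, ((k + 1 : ℕ) : ℝ≥0∞) ^ p * {s : ℝ≥0∞ | (k : ℝ≥0∞) ≤ s}.indicator 1 t := by
  by_cases ht : t = ∞
  · subst ht
    have h : (∞ : ℝ≥0∞) ≤ ∑' _ : ℕ, 1 := by simp
    refine (le_top.trans h).trans (ENNReal.tsum_le_tsum fun k => ?_)
    simp only [Set.indicator_apply, Set.mem_ofPred_eq, le_top, if_true, Pi.one_apply, mul_one]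
    exact one_le_pow₀ (by simp)
  · lift t to ℝ≥0 using ht
    refine le_trans ?_ (ENNReal.le_tsum ⌊t⌋₊)
    have h : ((⌊t⌋₊ : ℕ) : ℝ≥0∞) ≤ t := by exact_mod_cast Nat.floor_le zero_le
    rw [Set.indicator_of_mem (by exact h), Pi.one_apply, mul_one]
    gcongr
    exact_mod_cast (Nat.lt_floor_add_one t).le

lemma IsPoissonProcess.lintegral_infEDist_pow_le {d : ℕ} {Ω : Type*} [MeasurableSpace Ω]
    {P : Measure Ω} [IsProbabilityMeasure P] {lam : ℝ} {η : Ω → Set (Space d)}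
    (hη : IsPoissonProcess P lam η) (hd : 1 ≤ d) (hlam : 0 < lam) (z : Space d) (p : ℕ) :
    ∫⁻ ω, Metric.infEDist z (η ω) ^ (d * p) ∂P ≤
      ((unitBallVolume d)⁻¹ ^ p * expMoment p) * (ENNReal.ofReal lam)⁻¹ ^ p := by
  have hl0 : ENNReal.ofReal lam ≠ 0 := by simpa using hlam
  have ha0 : ENNReal.ofReal lam * unitBallVolume d ≠ 0 :=
    mul_ne_zero hl0 (unitBallVolume_ne_zero d)
  have hat : ENNReal.ofReal lam * unitBallVolume d ≠ ∞ :=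
    ENNReal.mul_ne_top ENNReal.ofReal_ne_top (unitBallVolume_ne_top d)
  let a := ENNReal.ofReal lam * unitBallVolume d
  let t : Ω → ℝ≥0∞ := fun ω => a * Metric.infEDist z (η ω) ^ d
  have ht : Measurable t := ((hη.measurable_infEDist_self z).pow_const d).const_mul a
  have hS : ∀ k : ℕ, MeasurableSet {s : ℝ≥0∞ | (k : ℝ≥0∞) ≤ s} := fun k => measurableSet_Ici
  have hind : ∀ k : ℕ, Measurable fun ω => {s : ℝ≥0∞ | (k : ℝ≥0∞) ≤ s}.indicator
      (1 : ℝ≥0∞ → ℝ≥0∞) (t ω) := fun k => (measurable_one.indicator (hS k)).comp ht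
  calc _ = ∫⁻ ω, a⁻¹ ^ p * t ω ^ p ∂P := by
        refine lintegral_congr fun ω => ?_
        rw [← mul_pow, ← mul_assoc, ENNReal.inv_mul_cancel ha0 hat, one_mul, pow_mul]
    _ = a⁻¹ ^ p * ∫⁻ ω, t ω ^ p ∂P := lintegral_const_mul _ (ht.pow_const p)
    _ ≤ a⁻¹ ^ p * ∫⁻ ω, ∑' k : ℕ, ((k + 1 : ℕ) : ℝ≥0∞) ^ p *
          {s : ℝ≥0∞ | (k : ℝ≥0∞) ≤ s}.indicator 1 (t ω) ∂P := by
        gcongr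
        exact pow_le_tsum_indicator _ _
    _ = a⁻¹ ^ p * ∑' k : ℕ, ((k + 1 : ℕ) : ℝ≥0∞) ^ p * P {ω | (k : ℝ≥0∞) ≤ t ω} := by
        rw [lintegral_tsum fun k => ((hind k).const_mul _).aemeasurable]
        congr 2
        ext k
        rw [lintegral_const_mul _ (hind k)]
        congr 1
        exact lintegral_indicator_one (ht (hS k))
    _ ≤ a⁻¹ ^ p * expMoment p := by
        gcongr
        exact ENNReal.tsum_le_tsum fun k => by
          gcongr
          exact hη.measure_le_infEDist_pow hd hlam z k
    _ = _ := by
        rw [ENNReal.mul_inv (Or.inl hl0) (Or.inl ENNReal.ofReal_ne_top), mul_pow]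
        ring

lemma nearestDist_univ {d : ℕ} (S : Set (Space d)) (z : Space d) :
    nearestDist S Set.univ z = Metric.infEDist z S := by
  simp [nearestDist]

/-- The constants in the moment bounds for the distance to the nearest point. -/
noncomputable def nearestConst (d p : ℕ) : ℝ≥0∞ := (unitBallVolume d)⁻¹ ^ p * expMoment p

lemma nearestConst_ne_top (d p : ℕ) : nearestConst d p ≠ ∞ :=
  ENNReal.mul_ne_top (ENNReal.pow_ne_top (ENNReal.inv_ne_top.2 (unitBallVolume_ne_zero d)))
    (expMoment_ne_top p)

/-- The constant in the moment bound for the Voronoi approximation. -/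
noncomputable def voronoiConst (d m : ℕ) : ℝ≥0∞ :=
  (m + 1 : ℕ) * ((m + 1 : ℕ) * (2 ^ d * unitBallVolume d *
    (momentConst d (nearestConst d) (m - 1) 1 + (nearestConst d 0 + nearestConst d 1) ^ m)))

lemma voronoiConst_ne_top (d m : ℕ) : voronoiConst d m ≠ ∞ := by
  refine ENNReal.mul_ne_top (by simp) (ENNReal.mul_ne_top (by simp) (ENNReal.mul_ne_top
    (ENNReal.mul_ne_top (by simp) (unitBallVolume_ne_top d)) (ENNReal.add_ne_top.2 ⟨?_, ?_⟩)))
  · exact momentConst_ne_top (nearestConst_ne_top d) _ _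
  · exact ENNReal.pow_ne_top (ENNReal.add_ne_top.2
      ⟨nearestConst_ne_top d 0, nearestConst_ne_top d 1⟩)

lemma momentSum_ne_top {V l : ℝ≥0∞} (hV : V ≠ ∞) (hl : l ≠ ∞) (m N : ℕ) :
    momentSum V l m N ≠ ∞ :=
  ENNReal.sum_ne_top.2 fun _ _ => ENNReal.mul_ne_top (ENNReal.pow_ne_top hV)
    (ENNReal.pow_ne_top hl)

lemma toReal_momentSum {V : ℝ≥0∞} (hV : V ≠ ∞) {lam : ℝ} (hlam : 0 < lam) (m : ℕ) :
    (momentSum V (ENNReal.ofReal lam)⁻¹ m 1).toReal =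
      ∑ k ∈ Finset.Icc 1 m, V.toReal ^ (m + 1 - k) * lam ^ (-(k : ℤ)) := by
  have hl : (ENNReal.ofReal lam)⁻¹ ≠ ∞ := ENNReal.inv_ne_top.2 (by simpa using hlam)
  rw [momentSum, ENNReal.toReal_sum fun _ _ => ENNReal.mul_ne_top (ENNReal.pow_ne_top hV)
    (ENNReal.pow_ne_top hl), ← Finset.Ico_add_one_right_eq_Icc, Finset.sum_Ico_eq_sum_range]
  refine Finset.sum_congr (by simp) fun k _ => ?_
  rw [ENNReal.toReal_mul, ENNReal.toReal_pow, ENNReal.toReal_pow, ENNReal.toReal_inv,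
    ENNReal.toReal_ofReal hlam.le, zpow_neg, zpow_natCast, inv_pow, add_comm 1 k,
    Nat.add_sub_add_right]

/-- The common part cancels, and two nonnegative remainders below `K` differ by at most `K`, not `2
* K`. -/
lemma abs_toReal_add_sub_le {a b c K : ℝ≥0∞} (ha : a ≠ ∞) (hb : b ≤ K) (hc : c ≤ K)
    (hK : K ≠ ∞) : |(a + b).toReal - (a + c).toReal| ≤ K.toReal := by
  rw [ENNReal.toReal_add ha (ne_top_of_le_ne_top hK hb),
    ENNReal.toReal_add ha (ne_top_of_le_ne_top hK hc), add_sub_add_left_eq_sub]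
  have h1 := ENNReal.toReal_mono hK hb
  have h2 := ENNReal.toReal_mono hK hc
  have h3 := ENNReal.toReal_nonneg (a := b)
  have h4 := ENNReal.toReal_nonneg (a := c)
  exact abs_sub_le_of_nonneg_of_le h3 h1 h4 h2

/-! ### Assembling the moment estimate -/

namespace IsPoissonProcess

variable {d : ℕ} {Ω : Type*} [MeasurableSpace Ω] {P : Measure Ω} [IsProbabilityMeasure P]
  {lam : ℝ} {η : Ω → Set (Space d)}

lemma lintegral_finitePow_univ_le (hη : IsPoissonProcess P lam η) (hd : 1 ≤ d) (hlam : 0 < lam)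
    (p : ℕ) : ∫⁻ ω, finitePow d p (nearestDist (η ω) Set.univ 0) ∂P ≤
      nearestConst d p * (ENNReal.ofReal lam)⁻¹ ^ p :=
  (lintegral_mono fun ω => finitePow_nearestDist_le (η ω) Set.univ 0).trans
    (hη.lintegral_infEDist_pow_le hd hlam 0 p)

lemma lintegral_finitePow_univ_ne_top (hη : IsPoissonProcess P lam η) (hd : 1 ≤ d)
    (hlam : 0 < lam) (p : ℕ) :
    ∫⁻ ω, finitePow d p (nearestDist (η ω) Set.univ 0) ∂P ≠ ∞ :=
  ne_top_of_le_ne_top (ENNReal.mul_ne_top (nearestConst_ne_top d p) (ENNReal.pow_ne_top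
    (ENNReal.inv_ne_top.2 (by simpa using hlam)))) (hη.lintegral_finitePow_univ_le hd hlam p)

/-- Exponent 0 gives the indicator of a finite distance. Finiteness of the d-th moment shows that η
is almost surely nonempty; this is what yields E Vol(A_η) = Vol(A). -/
lemma lintegral_finitePow_zero_univ (hη : IsPoissonProcess P lam η) (hd : 1 ≤ d)
    (hlam : 0 < lam) : ∫⁻ ω, finitePow d 0 (nearestDist (η ω) Set.univ 0) ∂P = 1 := by
  have h1 : ∫⁻ ω, Metric.infEDist 0 (η ω) ^ (d * 1) ∂P ≠ ∞ :=
    ne_top_of_le_ne_top (ENNReal.mul_ne_top (nearestConst_ne_top d 1) (ENNReal.pow_ne_top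
      (ENNReal.inv_ne_top.2 (by simpa using hlam)))) (hη.lintegral_infEDist_pow_le hd hlam 0 1)
  have h2 := ae_lt_top ((hη.measurable_infEDist_self 0).pow_const (d * 1)) h1
  have h3 : ∀ᵐ ω ∂P, finitePow d 0 (nearestDist (η ω) Set.univ 0) = 1 := by
    filter_upwards [h2] with ω hω
    have h4 : Metric.infEDist 0 (η ω) < ∞ := by
      by_contra h
      rw [not_lt, top_le_iff] at h
      rw [h, ENNReal.top_pow (by omega)] at hω
      exact lt_irrefl _ hω
    rw [nearestDist_univ, finitePow, if_pos h4, mul_zero, pow_zero]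
  rw [lintegral_congr_ae h3]
  simp

omit [IsProbabilityMeasure P] in
lemma lintegral_finitePow_zero_eq_volume (hη : IsPoissonProcess P lam η) (A : Set (Space d))
    (ω : Ω) :
    ∫⁻ z, finitePow d 0 (nearestDist (η ω) A z) = volume (voronoiApprox (η ω) A) := by
  have hm : Measurable fun z => nearestDist (η ω) A z :=
    Measurable.ite (measurableSet_le _root_.measurable_infEDist
      _root_.measurable_infEDist) _root_.measurable_infEDist measurable_const
  have h1 : voronoiApprox (η ω) A = {z | nearestDist (η ω) A z < ∞} := by
    ext z
    exact mem_voronoiApprox_iff (hη.locallyFinite ω) A z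
  rw [h1, ← lintegral_indicator_one (measurableSet_lt hm measurable_const)]
  refine lintegral_congr fun z => ?_
  simp [finitePow, Set.indicator_apply]

omit [IsProbabilityMeasure P] in
lemma measurable_volume_voronoiApprox (hη : IsPoissonProcess P lam η) {A : Set (Space d)}
    (hA : MeasurableSet A) : Measurable fun ω => volume (voronoiApprox (η ω) A) := by
  simp_rw [← hη.lintegral_finitePow_zero_eq_volume A]
  exact Measurable.lintegral_prod_right'
    (f := fun y : Ω × Space d => finitePow d 0 (nearestDist (η y.1) A y.2))
    ((measurable_finitePow d 0).comp (hη.measurable_nearestDist_prod hA))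

theorem moment_voronoiApprox (hη : IsPoissonProcess P lam η) (hd : 1 ≤ d) (hlam : 0 < lam)
    {A : Set (Space d)} (hA : MeasurableSet A) (hvol : volume A ≠ ∞) (m : ℕ) :
    (∀ᵐ ω ∂P, volume (voronoiApprox (η ω) A) ≠ ∞) ∧
    Integrable (fun ω => (volume.real (voronoiApprox (η ω) A)) ^ (m + 1)) P ∧
    |(∫ ω, (volume.real (voronoiApprox (η ω) A)) ^ (m + 1) ∂P) - (volume.real A) ^ (m + 1)| ≤
      (voronoiConst d m).toReal *
        ∑ k ∈ Finset.Icc 1 m, (volume.real A) ^ (m + 1 - k) * lam ^ (-(k : ℤ)) := by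
  set l := (ENNReal.ofReal lam)⁻¹ with hl
  have hlt : l ≠ ∞ := ENNReal.inv_ne_top.2 (by simpa using hlam)
  have hI : ∀ p, ∫⁻ ω, (∫⁻ z, finitePow d p (nearestDist (η ω) A z)) ∂P ≤
      nearestConst d p * volume A * l ^ p := by
    intro p
    rw [hη.lintegral_finitePow_nearestDist hd hlam hA p
      (hη.lintegral_finitePow_univ_ne_top hd hlam p)]
    calc _ ≤ volume A * (nearestConst d p * l ^ p) := by
          gcongr
          exact hη.lintegral_finitePow_univ_le hd hlam p
      _ = _ := by ring
  have hV : ∫⁻ ω, (∫⁻ z, finitePow d 0 (nearestDist (η ω) A z)) ∂P = volume A := by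
    rw [hη.lintegral_finitePow_nearestDist hd hlam hA 0
      (hη.lintegral_finitePow_univ_ne_top hd hlam 0), hη.lintegral_finitePow_zero_univ hd hlam,
      mul_one]
  obtain ⟨a, b, c, h1, h2, hb, hc⟩ := exists_moment_decomposition
    (hη.measurable_nearestDist_prod hA) (hη.decouplesOnSeparated hA) hI hV m
  simp_rw [hη.lintegral_finitePow_zero_eq_volume A] at h1
  have hK : voronoiConst d m * momentSum (volume A) l m 1 ≠ ∞ :=
    ENNReal.mul_ne_top (voronoiConst_ne_top d m) (momentSum_ne_top hvol hlt m 1)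
  have hb' : b ≤ voronoiConst d m * momentSum (volume A) l m 1 := by
    refine hb.trans ?_
    rw [voronoiConst]
    gcongr
    exact le_self_add
  have hc' : c ≤ voronoiConst d m * momentSum (volume A) l m 1 := by
    refine hc.trans ?_
    rw [voronoiConst]
    gcongr
    exact le_add_self
  -- The disjoint part is bounded by the finite `volume A ^ (m + 1)`; finiteness of the moment of
  -- the approximation follows from this.
  have ha : a ≠ ∞ :=
    ne_top_of_le_ne_top (ENNReal.pow_ne_top hvol) (h2 ▸ le_self_add : a ≤ volume A ^ (m + 1))
  have hmeas := (hη.measurable_volume_voronoiApprox hA).pow_const (m + 1)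
  have hfin : ∫⁻ ω, volume (voronoiApprox (η ω) A) ^ (m + 1) ∂P ≠ ∞ := by
    rw [h1]
    exact ENNReal.add_ne_top.2 ⟨ha, ne_top_of_le_ne_top hK hb'⟩
  have hae := ae_lt_top hmeas hfin
  have hreal : ∀ ω, volume.real (voronoiApprox (η ω) A) ^ (m + 1) =
      (volume (voronoiApprox (η ω) A) ^ (m + 1)).toReal := fun ω => by
    rw [ENNReal.toReal_pow]; rfl
  refine ⟨?_, ?_, ?_⟩
  · filter_upwards [hae] with ω hω h
    rw [h, ENNReal.top_pow (by omega)] at hω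
    exact lt_irrefl _ hω
  · simp_rw [hreal]
    exact integrable_toReal_of_lintegral_ne_top hmeas.aemeasurable hfin
  · simp_rw [hreal]
    rw [integral_toReal hmeas.aemeasurable hae, h1, measureReal_def, ← ENNReal.toReal_pow, h2,
      ← toReal_momentSum hvol hlam, ← ENNReal.toReal_mul]
    exact abs_toReal_add_sub_le ha hb' hc' hK

end IsPoissonProcess

/-! ### Large intensities and the main theorem -/

lemma sum_pow_mul_zpow_le {V lam : ℝ} (hV : 0 ≤ V) (hlam : 0 < lam) (h : V = 0 ∨ 1 ≤ V * lam)
    (m : ℕ) : ∑ k ∈ Finset.Icc 1 m, V ^ (m + 1 - k) * lam ^ (-(k : ℤ)) ≤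
      (m + 1 : ℕ) * (V ^ m * lam⁻¹) := by
  have h1 : ∀ k ∈ Finset.Icc 1 m, V ^ (m + 1 - k) * lam ^ (-(k : ℤ)) ≤ V ^ m * lam⁻¹ := by
    intro k hk
    obtain ⟨hk1, hkm⟩ := Finset.mem_Icc.1 hk
    rcases h with rfl | h
    · rw [zero_pow (by omega), zero_mul]
      positivity
    · have h2 : V ^ m * lam⁻¹ = V ^ (m + 1 - k) * lam ^ (-(k : ℤ)) * (V * lam) ^ (k - 1) := by
        obtain ⟨j, rfl⟩ := Nat.exists_eq_add_of_le hk1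
        obtain ⟨i, rfl⟩ := Nat.exists_eq_add_of_le hkm
        rw [show 1 + j + i + 1 - (1 + j) = i + 1 by omega, show 1 + j - 1 = j by omega, zpow_neg,
          zpow_natCast, mul_pow]
        field_simp
        ring
      rw [h2]
      exact le_mul_of_one_le_right (by positivity) (one_le_pow₀ h)
  calc _ ≤ ∑ k ∈ Finset.Icc 1 m, V ^ m * lam⁻¹ := Finset.sum_le_sum h1
    _ = m * (V ^ m * lam⁻¹) := by simp
    _ ≤ _ := by
      gcongr
      omega

theorem mainTheorem2 (d : ℕ) (hd : 1 ≤ d) (n : ℕ) (hn : 1 ≤ n) :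
    ∃ C : ℝ, ∀ A : Set (Space d), MeasurableSet A → volume A ≠ ∞ →
      (∀ lam : ℝ, 0 < lam →
        ∀ (Ω : Type u) [MeasurableSpace Ω] (P : Measure Ω) [IsProbabilityMeasure P]
          (η : Ω → Set (Space d)), IsPoissonProcess P lam η →
          (∀ᵐ ω ∂P, volume (voronoiApprox (η ω) A) ≠ ∞) ∧
          Integrable (fun ω => (volume.real (voronoiApprox (η ω) A)) ^ n) P ∧
          |(∫ ω, (volume.real (voronoiApprox (η ω) A)) ^ n ∂P) - (volume.real A) ^ n| ≤
            C * ∑ k ∈ Finset.Icc 1 (n - 1), (volume.real A) ^ (n - k) * lam ^ (-(k : ℤ))) ∧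
      (∃ lam₀ : ℝ, 0 < lam₀ ∧ ∀ lam : ℝ, lam₀ ≤ lam →
        ∀ (Ω : Type u) [MeasurableSpace Ω] (P : Measure Ω) [IsProbabilityMeasure P]
          (η : Ω → Set (Space d)), IsPoissonProcess P lam η →
          |(∫ ω, (volume.real (voronoiApprox (η ω) A)) ^ n ∂P) - (volume.real A) ^ n| ≤
            C * (volume.real A) ^ (n - 1) * lam⁻¹) := by
  obtain ⟨m, rfl⟩ : ∃ m, n = m + 1 := ⟨n - 1, by omega⟩
  have hC : 0 ≤ (voronoiConst d m).toReal := ENNReal.toReal_nonneg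
  -- The factor `m + 1` absorbs the number of terms in (ii) and only weakens (i), so one constant
  -- serves both.
  refine ⟨(voronoiConst d m).toReal * (m + 1 : ℕ), fun A hA hvol => ⟨?_, ?_⟩⟩
  · intro lam hlam Ω _ P _ η hη
    obtain ⟨h1, h2, h3⟩ := hη.moment_voronoiApprox hd hlam hA hvol m
    refine ⟨h1, h2, h3.trans ?_⟩
    rw [Nat.add_sub_cancel]
    gcongr
    exact le_mul_of_one_le_right hC (by simp)
  · have hV : 0 ≤ volume.real A := measureReal_nonneg
    -- The threshold is where `Vol(A) * lam ≥ 1` begins; for a null set any positive value works.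
    refine ⟨if volume.real A = 0 then 1 else (volume.real A)⁻¹, ?_, ?_⟩
    · split_ifs with h
      · exact one_pos
      · exact inv_pos.2 (hV.lt_of_ne' h)
    · intro lam hlam₀ Ω _ P _ η hη
      have hlam : 0 < lam ∧ (volume.real A = 0 ∨ 1 ≤ volume.real A * lam) := by
        split_ifs at hlam₀ with h
        · exact ⟨one_pos.trans_le hlam₀, Or.inl h⟩
        · have hpos : 0 < volume.real A := hV.lt_of_ne' h
          exact ⟨(inv_pos.2 hpos).trans_le hlam₀, Or.inr ((inv_le_iff_one_le_mul₀' hpos).1 hlam₀)⟩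
      refine (hη.moment_voronoiApprox hd hlam.1 hA hvol m).2.2.trans ?_
      rw [Nat.add_sub_cancel, mul_assoc _ _ lam⁻¹, mul_assoc]
      gcongr
      exact sum_pow_mul_zpow_le hV hlam.1 hlam.2 m
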